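/- Let $a>b>0$, $c=\sqrt{a^2-b^2}$, $h(z)=\frac{(\Re z)^2}{a^2}+\frac{(\Im z)^2}{b^2}$ and $E=\{z\in\mathbb C: h(z)<1\}$. Let $d^2z$ be the planar Lebesgue measure, $\Delta_N(z)=\prod_{i>j}(z_i-z_j)$ with $1\le i,j\le N$, let $F={}_2F_1$ be Gauss' hypergeometric function, $(x)_n=x(x+1)\cdots(x+n-1)$, and let $C_n^{(\lambda)}$ be the Gegenbauer polynomials, given by $C_0^{(\lambda)}=1$, $C_1^{(\lambda)}(x)=2\lambda x$, $(n+2)C^{(\lambda)}_{n+2}(x)=2(n+1+\lambda)xC^{(\lambda)}_{n+1}(x)-(n+2\lambda)C^{(\lambda)}_n(x)$. (1) For every real $\alpha>-1$ the polynomials $\tilde p_n(z)=\frac{n!\,c^n}{2^n(1+\alpha)_n}C_n^{(1+\alpha)}(z/c)$, $n\ge 0$, are monic of degree $n$ and satisfy $$\int_E\tilde p_n(z)\overline{\tilde p_m(z)}\,(1+\alpha)(1-h(z))^\alpha\frac{d^2z}{\pi ab}=\delta_{n,m}\tilde h_n,$$ with absolutely convergent integrals and $$\tilde h_n=\frac{n!^2c^{2n}}{2^{2n}(1+\alpha)_n^2}\,\frac{1+\alpha}{1+\alpha+n}\,C_n^{(1+\alpha)}\!\left(\frac{a^2+b^2}{a^2-b^2}\right)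 =\left(\frac c2\right)^{2n}\frac{\sqrt\pi\,\Gamma(2+\alpha)\Gamma(2+2\alpha+n)\Gamma(n+1)}{2^{2\alpha+1}\Gamma(\alpha+\frac32)\Gamma(1+\alpha+n)\Gamma(2+\alpha+n)}\,F\!\left(2+2\alpha+n,-n;\alpha+\tfrac32;-\tfrac{b^2}{c^2}\right).$$ (2) For every real $\alpha>-1$ and every integer $N\ge 0$ the following integral converges absolutely and $$\int_{E^N}|\Delta_N(z)|^2\prod_{i=1}^N\left(1-\frac{(\Re z_i)^2}{a^2}-\frac{(\Im z_i)^2}{b^2}\right)^{\alpha}\frac{d^2z_i}{\pi ab} = N!\,\frac{\pi^{N/2}\,\Gamma(1+\alpha)^N}{2^{(2\alpha+1)N}\,\Gamma(\alpha+\frac32)^N}\left(\frac c2\right)^{N(N-1)}\prod_{n=0}^{N-1}\frac{\Gamma(2+2\alpha+n)\Gamma(n+1)}{\Gamma(1+\alpha+n)\Gamma(2+\alpha+n)}\,F\!\left(2+2\alpha+n,-n;\alpha+\tfrac32;-\tfrac{b^2}{c^2}\right).$$ (3) The identity in (2) continues analytically in $\alpha$: for every complex $\alpha$ with $\Re\alpha>-1$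 the integral in (2) converges absolutely and equals the right-hand side; the integral is a holomorphic function of $\alpha$ in this half-plane; and the right-hand side is a meromorphic function of $\alpha\in\mathbb C$. -/

import Mathlib

open MeasureTheory

/-- The interior of the ellipse with half-axes `a` (real direction) and `b` (imaginary direction). -/
def ellipseInterior (a b : ℝ) : Set ℂ :=
  {z : ℂ | z.re ^ 2 / a ^ 2 + z.im ^ 2 / b ^ 2 < 1}

/-- The right focus `c = √(a² - b²)` of the ellipse. -/
noncomputable def ellipseFocus (a b : ℝ) : ℝ := Real.sqrt (a ^ 2 - b ^ 2)

/-- The base `1 - (Re z)²/a² - (Im z)²/b²` of the weight function. -/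
noncomputable def ellipseWeightBase (a b : ℝ) (z : ℂ) : ℝ :=
  1 - z.re ^ 2 / a ^ 2 - z.im ^ 2 / b ^ 2

/-- The Vandermonde product `∏_{i > j} (z i - z j)`. -/
noncomputable def vandermondeProduct {N : ℕ} (z : Fin N → ℂ) : ℂ :=
  ∏ i, ∏ j ∈ Finset.Iio i, (z i - z j)

/-- The Gegenbauer polynomials `C_n^{(l)}`, by their three-term recurrence
`(n + 2) C_{n+2} = 2 (n + 1 + l) x C_{n+1} - (n + 2 l) C_n`. -/
noncomputable def gegenbauerPoly (l : ℝ) : ℕ → Polynomial ℝ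
  | 0 => 1
  | 1 => Polynomial.C (2 * l) * Polynomial.X
  | n + 2 =>
      Polynomial.C (2 * ((n : ℝ) + 1 + l) / ((n : ℝ) + 2)) * Polynomial.X
          * gegenbauerPoly l (n + 1)
        - Polynomial.C (((n : ℝ) + 2 * l) / ((n : ℝ) + 2)) * gegenbauerPoly l n

/-- The rescaled Gegenbauer polynomial `n! cⁿ / (2ⁿ (1 + α)_n) C_n^{(1+α)}(z / c)`. -/
noncomputable def scaledGegenbauerPoly (α c : ℝ) (n : ℕ) : Polynomial ℝ :=
  Polynomial.C ((n.factorial : ℝ) * c ^ n / (2 ^ n * (ascPochhammer ℝ n).eval (1 + α)))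
    * (gegenbauerPoly (1 + α) n).comp (Polynomial.C c⁻¹ * Polynomial.X)

/-- The integrand of the orthogonality relation of the rescaled Gegenbauer polynomials, with respect
to `d²z`; the factor `(1 + α) (1 - h(z))^α / (π a b)` is the density of the weighted area measure. -/
noncomputable def gegenbauerPairing (a b α : ℝ) (n m : ℕ) (z : ℂ) : ℂ :=
  Polynomial.aeval z (scaledGegenbauerPoly α (ellipseFocus a b) n)
    * (starRingEnd ℂ) (Polynomial.aeval z (scaledGegenbauerPoly α (ellipseFocus a b) m))
    * (((1 + α) * ellipseWeightBase a b z ^ α / (Real.pi * a * b) : ℝ) : ℂ)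

/-- The domain `E^N`. -/
def ellipsePower (a b : ℝ) (N : ℕ) : Set (Fin N → ℂ) :=
  Set.univ.pi fun _ => ellipseInterior a b

/-- The integrand `|Δ_N(z)|² ∏ (1 - h(z_i))^α / (π a b)`, for a real exponent. -/
noncomputable def selbergIntegrand (a b α : ℝ) (N : ℕ) (z : Fin N → ℂ) : ℝ :=
  ‖vandermondeProduct z‖ ^ 2 * ∏ i, (ellipseWeightBase a b (z i) ^ α / (Real.pi * a * b))

/-- The same integrand for a complex exponent. -/
noncomputable def selbergIntegrandComplex (a b : ℝ) (α : ℂ) (N : ℕ) (z : Fin N → ℂ) : ℂ :=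
  ((‖vandermondeProduct z‖ ^ 2 : ℝ) : ℂ)
    * ∏ i, ((ellipseWeightBase a b (z i) : ℂ) ^ α / ((Real.pi * a * b : ℝ) : ℂ))

/-- The closed form of the integral, as a function of a complex exponent `α`. -/
noncomputable def selbergClosedFormComplex (a b : ℝ) (N : ℕ) (α : ℂ) : ℂ :=
  (N.factorial : ℂ)
    * ((Real.pi : ℂ) ^ ((N : ℂ) / 2) * Complex.Gamma (1 + α) ^ N
        / ((2 : ℂ) ^ ((2 * α + 1) * N) * Complex.Gamma (α + 3 / 2) ^ N))
    * ((ellipseFocus a b : ℂ) / 2) ^ (N * (N - 1))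
    * ∏ n ∈ Finset.range N,
        (Complex.Gamma (2 + 2 * α + n) * Complex.Gamma ((n : ℂ) + 1)
            / (Complex.Gamma (1 + α + n) * Complex.Gamma (2 + α + n))
          * ordinaryHypergeometric (2 + 2 * α + (n : ℂ)) (-(n : ℂ)) (α + 3 / 2)
              (-(b : ℂ) ^ 2 / (ellipseFocus a b : ℂ) ^ 2))

/-!
The linear map `w ↦ z = a Re w + i b Im w` carries the unit disc to the ellipse and the weight
`(1 - |w|²)^α` to the weight of the ellipse. Under this map `z / c` is the linear form
`(u w̄ + u⁻¹ w) / 2` with `u = (a - b) / c`, which is the coordinate of `w` in the direction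
`u = exp(i θ)`, continued to a complex angle; `z̄ / c` is the same with `u = (a + b) / c`. So the
polynomials of the theorem are Gegenbauer ridge polynomials on the disc, and the theorem follows
from two facts about them: ridge polynomials of different degrees are orthogonal, and those of
degree `n` in the directions `u`, `v` have the pairing `C_n((u / v + v / u) / 2) / (l + n)`, where
`l = 1 + α`.

Both facts are proved algebraically for complex `l` with `Re l > 0`, for the linear functional on
polynomials in `w`, `w̄` that has the moments of the disc weight (`IsDiscFunctional`); these moments
are Beta integrals. The operator `discOperator` is symmetric for this functional, the Gegenbauer
differential equation makes ridge polynomials its eigenfunctions, and it is triangular on monomials;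
hence a ridge polynomial of degree `n` is orthogonal to everything of smaller degree
(`IsDiscFunctional.gegenbauer_mul_X_pow_eq_zero`). Its moments against monomials of degree exactly
`n` are found by integrating by parts along the direction in which it is constant
(`IsDiscFunctional.gegenbauer_mul_X_pow_succ`), and they sum up to a Gegenbauer polynomial by the
expansion of `C_n((q + q⁻¹) / 2)` in powers of `q`. The hypergeometric form of the norms comes from
the same differential equation and from the duplication formula for the Gamma function.

For the integral over `E^N`, both the Vandermonde product of the `z_i` and that of the `z̄_i` are
determinants of the monic polynomials `p_j`, and Andréief's identity (`integral_det_mul_det`) gives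
`N!` times the product of the norms. With the bilinear pairing `p_n(z) p_m(z̄)`, in place of the
Hermitian one, this works for every complex `α` with `Re α > -1`; holomorphy in `α` is then visible
from the norms, which are rational functions of `α`.
-/

/-! ### Gegenbauer polynomials with a complex parameter -/

section Pochhammer

theorem ascPochhammer_eval_ne_zero_of_re_pos {l : ℂ} (hl : 0 < l.re) (n : ℕ) :
    (ascPochhammer ℂ n).eval l ≠ 0 := by
  rw [Ne, ascPochhammer_eval_eq_zero_iff]
  rintro ⟨k, -, hk⟩
  have := congrArg Complex.re hk
  simp at this
  have hk : (0 : ℝ) ≤ k := k.cast_nonneg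
  linarith

theorem add_natCast_ne_zero_of_re_pos {l : ℂ} (hl : 0 < l.re) (n : ℕ) : l + n ≠ 0 := fun h => by
  have := congrArg Complex.re h
  simp at this
  have hk : (0 : ℝ) ≤ n := n.cast_nonneg
  linarith

/-- The hypergeometric series with upper parameter `-n` terminates. -/
theorem ordinaryHypergeometric_neg_natCast (n : ℕ) (s t x : ℂ) :
    ordinaryHypergeometric s (-(n : ℂ)) t x = ∑ k ∈ Finset.range (n + 1),
      ((k.factorial : ℂ)⁻¹ * (ascPochhammer ℂ k).eval s * (ascPochhammer ℂ k).eval (-(n : ℂ))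
        * ((ascPochhammer ℂ k).eval t)⁻¹) * x ^ k := by
  rw [ordinaryHypergeometric_eq_tsum]
  beta_reduce
  rw [tsum_eq_sum (s := Finset.range (n + 1))]
  · rfl
  · intro k hk
    have : (ascPochhammer ℂ k).eval (-(n : ℂ)) = 0 := by
      rw [ascPochhammer_eval_eq_zero_iff]
      exact ⟨n, by simpa using hk, by simp⟩
    simp [this]

end Pochhammer

open Polynomial in
/-- The Gegenbauer polynomials `C_n^{(l)}` for a complex parameter `l`. -/
noncomputable def complexGegenbauer (l : ℂ) : ℕ → ℂ[X]
  | 0 => 1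
  | 1 => C (2 * l) * X
  | n + 2 =>
      C (2 * ((n : ℂ) + 1 + l) / ((n : ℂ) + 2)) * X * complexGegenbauer l (n + 1)
        - C (((n : ℂ) + 2 * l) / ((n : ℂ) + 2)) * complexGegenbauer l n

section Gegenbauer

open Polynomial

theorem gegenbauerPoly_map_ofReal (l : ℝ) (n : ℕ) :
    (gegenbauerPoly l n).map Complex.ofRealHom = complexGegenbauer l n := by
  induction n using Nat.twoStepInduction with
  | zero => simp [gegenbauerPoly, complexGegenbauer]
  | one => simp [gegenbauerPoly, complexGegenbauer]
  | more n h0 h1 => simp [gegenbauerPoly, complexGegenbauer, h0, h1]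

theorem complexGegenbauer_recurrence (l : ℂ) (n : ℕ) :
    ((n : ℂ[X]) + 2) * complexGegenbauer l (n + 2) =
      2 * ((n : ℂ[X]) + 1 + C l) * X * complexGegenbauer l (n + 1)
        - ((n : ℂ[X]) + 2 * C l) * complexGegenbauer l n := by
  have hn : ((n : ℂ) + 2) ≠ 0 := by exact_mod_cast (by omega : n + 2 ≠ 0)
  have h1 : ((n : ℂ[X]) + 2) * C (2 * ((n : ℂ) + 1 + l) / ((n : ℂ) + 2))
      = 2 * ((n : ℂ[X]) + 1 + C l) := by
    rw [show ((n : ℂ[X]) + 2) = C ((n : ℂ) + 2) by simp [C_ofNat], ← C_mul, mul_div_cancel₀ _ hn]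
    simp [C_ofNat]
  have h2 : ((n : ℂ[X]) + 2) * C (((n : ℂ) + 2 * l) / ((n : ℂ) + 2))
      = (n : ℂ[X]) + 2 * C l := by
    rw [show ((n : ℂ[X]) + 2) = C ((n : ℂ) + 2) by simp [C_ofNat], ← C_mul, mul_div_cancel₀ _ hn]
    simp [C_ofNat]
  rw [complexGegenbauer]
  linear_combination (X * complexGegenbauer l (n + 1)) * h1 - complexGegenbauer l n * h2

/-- The two first-order differential relations between consecutive Gegenbauer polynomials. They
are proved together, since the inductive step for either one uses both. -/
theorem complexGegenbauer_derivative_relations (l : ℂ) (n : ℕ) :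
    (X * derivative (complexGegenbauer l (n + 1)) - derivative (complexGegenbauer l n)
        = ((n : ℂ[X]) + 1) * complexGegenbauer l (n + 1)) ∧
      (derivative (complexGegenbauer l (n + 1)) - X * derivative (complexGegenbauer l n)
        = ((n : ℂ[X]) + 2 * C l) * complexGegenbauer l n) := by
  induction n with
  | zero => constructor <;> simp [complexGegenbauer, C_ofNat]; ring
  | succ n ih =>
    obtain ⟨ha, hb⟩ := ih
    have hn : ((n : ℂ[X]) + 2) ≠ 0 := by exact_mod_cast (by omega : n + 2 ≠ 0)
    have hr := complexGegenbauer_recurrence l n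
    have hd := congrArg derivative hr
    simp only [derivative_mul, derivative_sub, derivative_add, derivative_natCast, derivative_X,
      derivative_C, derivative_ofNat, derivative_one] at hd
    set c0 := complexGegenbauer l n
    set c1 := complexGegenbauer l (n + 1)
    set c2 := complexGegenbauer l (n + 2)
    have hb' : derivative c2 - X * derivative c1 = ((n : ℂ[X]) + 1 + 2 * C l) * c1 := by
      apply mul_left_cancel₀ hn
      linear_combination hd + ((n : ℂ[X]) + 2 * C l) * ha
    push_cast
    refine ⟨?_, hb'⟩
    show X * derivative c2 - derivative c1 = _
    linear_combination X * hb' - hb + X * ha - hr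

/-- The Gegenbauer differential equation
`(1 - X²) C_n'' - (2 l + 1) X C_n' = - n (n + 2 l) C_n`. -/
theorem complexGegenbauer_ode (l : ℂ) (n : ℕ) :
    (1 - X ^ 2) * derivative (derivative (complexGegenbauer l n))
        - C (2 * l + 1) * X * derivative (complexGegenbauer l n)
      = - C ((n : ℂ) * (n + 2 * l)) * complexGegenbauer l n := by
  rcases n with _ | n
  · simp [complexGegenbauer]
  obtain ⟨ha, hb⟩ := complexGegenbauer_derivative_relations l n
  have hd := congrArg derivative (show (1 - X ^ 2) * derivative (complexGegenbauer l (n + 1))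
      = -(((n : ℂ[X]) + 1) * (X * complexGegenbauer l (n + 1)))
        + ((n : ℂ[X]) + 2 * C l) * complexGegenbauer l n by linear_combination hb - X * ha)
  simp only [derivative_mul, derivative_sub, derivative_add, derivative_neg, derivative_natCast,
    derivative_X, derivative_C, derivative_ofNat, derivative_one, derivative_X_pow] at hd
  push_cast at hd ⊢
  simp only [map_mul, map_add, map_ofNat, map_one, map_natCast]
  simp only [pow_one, C_ofNat] at hd
  linear_combination hd - ((n : ℂ[X]) + 2 * C l) * ha

theorem complexGegenbauer_natDegree_le (l : ℂ) (n : ℕ) :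
    (complexGegenbauer l n).natDegree ≤ n := by
  induction n using Nat.twoStepInduction with
  | zero => simp [complexGegenbauer]
  | one => exact (natDegree_C_mul_le _ _).trans natDegree_X_le
  | more n h0 h1 =>
    rw [complexGegenbauer]
    refine (natDegree_sub_le _ _).trans (max_le ?_ ?_)
    · refine natDegree_mul_le.trans ?_
      have := (natDegree_C_mul_le (2 * ((n : ℂ) + 1 + l) / ((n : ℂ) + 2)) X).trans natDegree_X_le
      omega
    · refine (natDegree_C_mul_le _ _).trans (by omega)

theorem complexGegenbauer_coeff_self (l : ℂ) (n : ℕ) :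
    (complexGegenbauer l n).coeff n = 2 ^ n * (ascPochhammer ℂ n).eval l / n.factorial := by
  induction n using Nat.twoStepInduction with
  | zero => simp [complexGegenbauer]
  | one => simp [complexGegenbauer]
  | more n h0 h1 =>
    have hn : ((n : ℂ) + 2) ≠ 0 := by exact_mod_cast (by omega : n + 2 ≠ 0)
    have hn' : ((n : ℂ) + 1) ≠ 0 := by exact_mod_cast (by omega : n + 1 ≠ 0)
    have hf : (n.factorial : ℂ) ≠ 0 := by exact_mod_cast n.factorial_ne_zero
    have h0' : (complexGegenbauer l n).coeff (n + 2) = 0 :=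
      coeff_eq_zero_of_natDegree_lt
        (lt_of_le_of_lt (complexGegenbauer_natDegree_le l n) (by omega))
    rw [complexGegenbauer, coeff_sub, mul_assoc, coeff_C_mul, coeff_X_mul, coeff_C_mul, h0', h1,
      ascPochhammer_succ_eval (n + 1), Nat.factorial_succ (n + 1), Nat.factorial_succ n]
    push_cast
    rw [show (n : ℂ) + 1 + 1 = n + 2 by ring]
    field_simp
    ring

/-- The coefficients `(l)_k / k!` of the binomial series `(1 - T)^{-l}`. -/
noncomputable def binomCoeff (l : ℂ) (k : ℕ) : ℂ := (ascPochhammer ℂ k).eval l / k.factorial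

theorem binomCoeff_succ (l : ℂ) (k : ℕ) :
    ((k : ℂ) + 1) * binomCoeff l (k + 1) = (l + k) * binomCoeff l k := by
  have hn' : ((k : ℂ) + 1) ≠ 0 := by exact_mod_cast (by omega : k + 1 ≠ 0)
  have hf : (k.factorial : ℂ) ≠ 0 := by exact_mod_cast k.factorial_ne_zero
  rw [binomCoeff, binomCoeff, ascPochhammer_succ_eval, Nat.factorial_succ]
  push_cast
  field_simp

/-- The logarithmic derivative of `(1 - s T)^{-l}`, as an identity of formal power series. -/
theorem derivative_binomSeries (l s : ℂ) :
    (1 - PowerSeries.C s * PowerSeries.X) *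
        PowerSeries.derivative ℂ (PowerSeries.mk fun k => binomCoeff l k * s ^ k)
      = PowerSeries.C (l * s) * (PowerSeries.mk fun k => binomCoeff l k * s ^ k) := by
  ext n
  rw [sub_mul, one_mul, map_sub, mul_assoc, PowerSeries.coeff_C_mul, PowerSeries.coeff_C_mul]
  rcases n with _ | n
  · have := binomCoeff_succ l 0
    simp [PowerSeries.coeff_derivative] at this ⊢
    rw [this]; ring
  · rw [PowerSeries.coeff_succ_X_mul]
    simp only [PowerSeries.coeff_derivative, PowerSeries.coeff_mk]
    have h1 := binomCoeff_succ l (n + 1)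
    push_cast at h1 ⊢
    linear_combination s ^ (n + 2) * h1

/-- The generating function of the Gegenbauer polynomials at `(q + q⁻¹) / 2` factors as
`(1 - q T)^{-l} (1 - q⁻¹ T)^{-l}`. -/
theorem complexGegenbauer_generating (l q r : ℂ) (hqr : q * r = 1) :
    (PowerSeries.mk fun n => (complexGegenbauer l n).eval ((q + r) / 2))
      = (PowerSeries.mk fun k => binomCoeff l k * q ^ k)
        * (PowerSeries.mk fun k => binomCoeff l k * r ^ k) := by
  set A := PowerSeries.mk fun k => binomCoeff l k * q ^ k with hA
  set B := PowerSeries.mk fun k => binomCoeff l k * r ^ k with hB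
  have hA' := derivative_binomSeries l q
  have hB' := derivative_binomSeries l r
  rw [← hA] at hA'
  rw [← hB] at hB'
  have hqr' : (PowerSeries.C q : PowerSeries ℂ) * PowerSeries.C r = 1 := by
    rw [← map_mul, hqr, map_one]
  -- the sum of the logarithmic derivatives, with denominators cleared, using `q r = 1`
  have key : (1 - PowerSeries.C (q + r) * PowerSeries.X + PowerSeries.X * PowerSeries.X) *
      PowerSeries.derivative ℂ (A * B)
      = PowerSeries.C (l * (q + r)) * (A * B) - PowerSeries.C (2 * l) * (PowerSeries.X * (A * B)) := by
    simp only [Derivation.leibniz, smul_eq_mul, map_add, map_mul, map_ofNat] at hA' hB' ⊢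
    linear_combination (B * (1 - PowerSeries.C r * PowerSeries.X)) * hA'
      + (A * (1 - PowerSeries.C q * PowerSeries.X)) * hB' + (-PowerSeries.X ^ 2 *
        (B * PowerSeries.derivative ℂ A + A * PowerSeries.derivative ℂ B)
        - 2 * PowerSeries.C l * PowerSeries.X * A * B) * hqr'
  ext n
  rw [PowerSeries.coeff_mk]
  induction n using Nat.twoStepInduction with
  | zero => simp [complexGegenbauer, hA, hB, binomCoeff]
  | one =>
    simp [complexGegenbauer, hA, hB, PowerSeries.coeff_mul, binomCoeff]
    simp [Finset.Nat.antidiagonal_succ, Finset.sum]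
    ring
  | more n h0 h1 =>
    have hn : ((n : ℂ) + 2) ≠ 0 := by exact_mod_cast (by omega : n + 2 ≠ 0)
    have hr := congrArg (eval ((q + r) / 2)) (complexGegenbauer_recurrence l n)
    simp only [eval_mul, eval_sub, eval_add, eval_natCast, eval_C, eval_X, eval_ofNat, eval_one]
      at hr
    have hk := congrArg (PowerSeries.coeff (n + 1)) key
    simp only [sub_mul, add_mul, one_mul, map_sub, map_add (PowerSeries.coeff (n + 1)), mul_assoc,
      PowerSeries.coeff_C_mul, PowerSeries.coeff_succ_X_mul, PowerSeries.coeff_derivative] at hk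
    apply mul_left_cancel₀ hn
    rcases n with _ | n
    · simp only [PowerSeries.coeff_zero_X_mul] at hk
      rw [hr, h0, h1]
      push_cast at hk ⊢
      linear_combination -hk
    · simp only [PowerSeries.coeff_succ_X_mul, PowerSeries.coeff_derivative] at hk
      rw [hr, h0, h1]
      push_cast at hk ⊢
      linear_combination -hk

/-- The expansion of `C_n^{(l)}(cos θ)` in powers of `q = exp(i θ)`. -/
theorem complexGegenbauer_eval_joukowski (l q r : ℂ) (hqr : q * r = 1) (n : ℕ) :
    (complexGegenbauer l n).eval ((q + r) / 2)
      = ∑ k ∈ Finset.range (n + 1), binomCoeff l k * binomCoeff l (n - k) * (q ^ k * r ^ (n - k)) := by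
  have h := congrArg (PowerSeries.coeff n) (complexGegenbauer_generating l q r hqr)
  rw [PowerSeries.coeff_mk, PowerSeries.coeff_mul,
    Finset.Nat.sum_antidiagonal_eq_sum_range_succ_mk] at h
  rw [h]
  refine Finset.sum_congr rfl fun k _ => ?_
  simp only [PowerSeries.coeff_mk]
  ring

theorem complexGegenbauer_eval_one (l : ℂ) (n : ℕ) :
    (complexGegenbauer l n).eval 1 = (ascPochhammer ℂ n).eval (2 * l) / n.factorial := by
  induction n using Nat.twoStepInduction with
  | zero => simp [complexGegenbauer]
  | one => simp [complexGegenbauer]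
  | more n h0 h1 =>
    have hn : ((n : ℂ) + 2) ≠ 0 := by exact_mod_cast (by omega : n + 2 ≠ 0)
    have hn' : ((n : ℂ) + 1) ≠ 0 := by exact_mod_cast (by omega : n + 1 ≠ 0)
    have hf : (n.factorial : ℂ) ≠ 0 := by exact_mod_cast n.factorial_ne_zero
    have hr := congrArg (eval 1) (complexGegenbauer_recurrence l n)
    simp only [eval_mul, eval_sub, eval_add, eval_natCast, eval_C, eval_X, eval_ofNat, eval_one]
      at hr
    apply mul_left_cancel₀ hn
    rw [hr, h0, h1, ascPochhammer_succ_eval (n + 1), ascPochhammer_succ_eval n,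
      Nat.factorial_succ (n + 1), Nat.factorial_succ n]
    push_cast
    rw [show (n : ℂ) + 1 + 1 = n + 2 by ring]
    field_simp
    ring

/-- Gegenbauer polynomials as terminating hypergeometric series: in the variable `y = (1 - x) / 2`
the differential equation is hypergeometric, and determines the coefficients from the value at
`y = 0`. -/
theorem complexGegenbauer_eval_eq_hypergeometric (l : ℂ) (hl : 0 < l.re) (n : ℕ) (y : ℂ) :
    (complexGegenbauer l n).eval (1 - 2 * y)
      = (ascPochhammer ℂ n).eval (2 * l) / n.factorial
        * ordinaryHypergeometric (2 * l + n) (-(n : ℂ)) (l + 1 / 2) y := by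
  set Q := (complexGegenbauer l n).comp (1 - 2 * X) with hQ
  have hd1 : derivative Q = -2 * (derivative (complexGegenbauer l n)).comp (1 - 2 * X) := by
    rw [hQ, derivative_comp]; simp
  have hd2 : derivative (derivative Q)
      = 4 * (derivative (derivative (complexGegenbauer l n))).comp (1 - 2 * X) := by
    rw [hd1, derivative_mul, derivative_comp]; simp; ring
  have hode : X * derivative (derivative Q) - X * (X * derivative (derivative Q))
      + C (l + 1 / 2) * derivative Q - C (2 * l + 1) * (X * derivative Q)
      + C ((n : ℂ) * (n + 2 * l)) * Q = 0 := by
    have h := congrArg (fun p : ℂ[X] => p.comp (1 - 2 * X)) (complexGegenbauer_ode l n)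
    simp only [sub_comp, mul_comp, one_comp, X_pow_comp, X_comp, C_comp, neg_comp, ← hQ] at h
    have hc : (C (2 * l + 1) : ℂ[X]) = 2 * C (l + 1 / 2) := by
      rw [← C_ofNat, ← C_mul]; congr 1; ring
    rw [hd2, hd1, hc]
    rw [hc] at h
    linear_combination h
  have hnd : Q.natDegree ≤ n := by
    refine natDegree_comp_le.trans ?_
    have h2 : (1 - 2 * X : ℂ[X]).natDegree ≤ 1 := by
      rw [show (1 - 2 * X : ℂ[X]) = C (-2) * X + C 1 by simp [C_ofNat]; ring]
      exact natDegree_linear_le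
    calc _ ≤ n * 1 := Nat.mul_le_mul (complexGegenbauer_natDegree_le l n) h2
      _ = n := mul_one n
  have hne : ∀ k : ℕ, l + 1 / 2 + k ≠ 0 :=
    add_natCast_ne_zero_of_re_pos (by simp; linarith)
  have hcoeff : ∀ k : ℕ, ((k : ℂ) + 1) * (l + 1 / 2 + k) * Q.coeff (k + 1)
      = (2 * l + n + k) * (-(n : ℂ) + k) * Q.coeff k := by
    intro k
    have h := congrArg (fun p : ℂ[X] => p.coeff k) hode
    simp only [coeff_add, coeff_sub, coeff_C_mul, coeff_zero] at h
    rcases k with _ | k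
    · simp only [mul_coeff_zero, coeff_X_zero, zero_mul, coeff_derivative] at h
      simp at h ⊢
      linear_combination h
    · rw [coeff_X_mul, coeff_X_mul, coeff_X_mul] at h
      rcases k with _ | k
      · simp only [mul_coeff_zero, coeff_X_zero, zero_mul, coeff_derivative] at h
        push_cast at h ⊢
        linear_combination h
      · rw [coeff_X_mul] at h
        simp only [coeff_derivative] at h
        push_cast at h ⊢
        linear_combination h
  have hval : ∀ k, Q.coeff k = (ascPochhammer ℂ n).eval (2 * l) / n.factorial
      * ordinaryHypergeometricCoefficient (2 * l + n) (-(n : ℂ)) (l + 1 / 2) k := by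
    intro k
    induction k with
    | zero =>
      rw [coeff_zero_eq_eval_zero, hQ, eval_comp, ordinaryHypergeometricCoefficient]
      simp [complexGegenbauer_eval_one]
    | succ k ih =>
      have hk : ((k : ℂ) + 1) ≠ 0 := by exact_mod_cast (by omega : k + 1 ≠ 0)
      apply mul_left_cancel₀ (mul_ne_zero hk (hne k))
      rw [hcoeff, ih, ordinaryHypergeometricCoefficient, ordinaryHypergeometricCoefficient]
      simp only [ascPochhammer_succ_eval, Nat.factorial_succ]
      push_cast
      simp only [mul_inv]
      have h1 : ((k : ℂ) + 1) * ((k : ℂ) + 1)⁻¹ = 1 := mul_inv_cancel₀ hk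
      have h2 : (l + 1 / 2 + k) * (l + 1 / 2 + k)⁻¹ = 1 := mul_inv_cancel₀ (hne k)
      generalize ((k : ℂ) + 1)⁻¹ = i1 at *
      generalize (l + 1 / 2 + (k : ℂ))⁻¹ = i2 at *
      generalize (eval (l + 1 / 2) (ascPochhammer ℂ k))⁻¹ = i3 at *
      generalize ((k.factorial : ℂ))⁻¹ = i4 at *
      generalize (eval (2 * l) (ascPochhammer ℂ n)) / (n.factorial : ℂ) = i5
      generalize (eval (2 * l + n) (ascPochhammer ℂ k)) = i6
      generalize (eval (-(n : ℂ)) (ascPochhammer ℂ k)) = i7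
      linear_combination (-(i5 * i4 * i6 * i7 * i3 * (2 * l + n + k) * (-(n : ℂ) + k)))
        * (h1 * ((l + 1 / 2 + k) * i2) + h2)
  have he : (complexGegenbauer l n).eval (1 - 2 * y) = Q.eval y := by
    rw [hQ, eval_comp]; simp
  rw [he, eval_eq_sum_range' (Nat.lt_succ_of_le hnd), ordinaryHypergeometric_neg_natCast,
    Finset.mul_sum]
  refine Finset.sum_congr rfl fun k _ => ?_
  rw [hval, ordinaryHypergeometricCoefficient, mul_assoc]

end Gegenbauer

/-! ### The functional of integration over the disc -/

section DiscFunctional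

open MvPolynomial

/-- A linear functional on polynomials in `w = X 0` and its conjugate `X 1` which has the moments of
the measure `(1 - |w|²)^(l - 1) d²w / π` on the unit disc. -/
def IsDiscFunctional (l : ℂ) (L : MvPolynomial (Fin 2) ℂ →ₗ[ℂ] ℂ) : Prop :=
  ∀ j k : ℕ, L (X 0 ^ j * X 1 ^ k) =
    if j = k then (j.factorial : ℂ) / (ascPochhammer ℂ (j + 1)).eval l else 0

theorem linearMap_ext_X_pow {L L' : MvPolynomial (Fin 2) ℂ →ₗ[ℂ] ℂ}
    (h : ∀ j k : ℕ, L (X 0 ^ j * X 1 ^ k) = L' (X 0 ^ j * X 1 ^ k)) : L = L' := by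
  refine (basisMonomials (Fin 2) ℂ).ext fun s => ?_
  have hs : (monomial s (1 : ℂ)) = X 0 ^ s 0 * X 1 ^ s 1 := by
    rw [monomial_eq, Finsupp.prod_fintype _ _ (fun i => pow_zero _), Fin.prod_univ_two]
    simp
  rw [coe_basisMonomials]
  beta_reduce
  rw [hs, h]

theorem pderiv_zero_X_pow (j k : ℕ) :
    pderiv 0 (X 0 ^ j * X 1 ^ k : MvPolynomial (Fin 2) ℂ) = C (j : ℂ) * (X 0 ^ (j - 1) * X 1 ^ k) := by
  simp [Derivation.leibniz, Derivation.leibniz_pow]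
  ring

theorem pderiv_one_X_pow (j k : ℕ) :
    pderiv 1 (X 0 ^ j * X 1 ^ k : MvPolynomial (Fin 2) ℂ) = C (k : ℂ) * (X 0 ^ j * X 1 ^ (k - 1)) := by
  simp [Derivation.leibniz, Derivation.leibniz_pow]
  ring

theorem linearMap_C_mul (L : MvPolynomial (Fin 2) ℂ →ₗ[ℂ] ℂ) (a : ℂ)
    (p : MvPolynomial (Fin 2) ℂ) :
    L (C a * p) = a * L p := by
  rw [C_mul', map_smul, smul_eq_mul]

theorem derivation_C_mul (d : Derivation ℂ (MvPolynomial (Fin 2) ℂ) (MvPolynomial (Fin 2) ℂ)) (a : ℂ)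
    (p : MvPolynomial (Fin 2) ℂ) : d (C a * p) = C a * d p := by
  rw [C_mul', Derivation.map_smul, C_mul']

theorem pderiv_zero_one_comm (f : MvPolynomial (Fin 2) ℂ) :
    pderiv 0 (pderiv 1 f) = pderiv 1 (pderiv 0 f) := by
  induction f using MvPolynomial.induction_on with
  | C a => simp
  | add p q hp hq => simp [hp, hq]
  | mul_X p i hp =>
    fin_cases i <;> simp [Derivation.leibniz, hp, add_comm]

namespace IsDiscFunctional

variable {l : ℂ} {L : MvPolynomial (Fin 2) ℂ →ₗ[ℂ] ℂ}

theorem apply_of_ne (hL : IsDiscFunctional l L) {j k : ℕ} (h : j ≠ k) :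
    L (X 0 ^ j * X 1 ^ k) = 0 := by rw [hL, if_neg h]

theorem apply_succ (hl : 0 < l.re) (hL : IsDiscFunctional l L) (j k : ℕ) :
    (l + j + 1) * L (X 0 ^ (j + 1) * X 1 ^ (k + 1)) = (j + 1) * L (X 0 ^ j * X 1 ^ k) := by
  rw [hL, hL]
  by_cases h : j = k
  · subst h
    have h1 := ascPochhammer_eval_ne_zero_of_re_pos hl (j + 1)
    have h2 := add_natCast_ne_zero_of_re_pos hl (j + 1)
    push_cast at h2
    rw [if_pos rfl, if_pos rfl, ascPochhammer_succ_eval (j + 1), Nat.factorial_succ]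
    push_cast
    rw [add_assoc] at *
    field_simp
  · simp [h]

/-- Integration by parts in the variable `w`. -/
theorem pderiv_zero_parts (hl : 0 < l.re) (hL : IsDiscFunctional l L)
    (f : MvPolynomial (Fin 2) ℂ) :
    L ((1 - X 0 * X 1) * pderiv 0 f - C l * (X 1 * f)) = 0 := by
  have h : L ∘ₗ (LinearMap.mulLeft ℂ (1 - X 0 * X 1) ∘ₗ (pderiv 0).toLinearMap
      - LinearMap.mulLeft ℂ (C l) ∘ₗ LinearMap.mulLeft ℂ (X 1)) = 0 := by
    refine linearMap_ext_X_pow fun j k => ?_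
    change L ((1 - X 0 * X 1) * pderiv 0 (X 0 ^ j * X 1 ^ k)
      - C l * (X 1 * (X 0 ^ j * X 1 ^ k))) = 0
    rw [pderiv_zero_X_pow]
    rcases j with _ | j
    · have := hL.apply_of_ne (show 0 ≠ k + 1 by omega)
      rw [show ((1 - X 0 * X 1) * (C ((0 : ℕ) : ℂ) * (X 0 ^ (0 - 1) * X 1 ^ k))
        - C l * (X 1 * (X 0 ^ 0 * X 1 ^ k)) : MvPolynomial (Fin 2) ℂ)
        = -(C l * (X 0 ^ 0 * X 1 ^ (k + 1))) by rw [Nat.cast_zero, C_0]; ring]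
      rw [map_neg, linearMap_C_mul, this]; simp
    · have := apply_succ hl hL j k
      rw [show ((1 - X 0 * X 1) * (C ((j + 1 : ℕ) : ℂ) * (X 0 ^ (j + 1 - 1) * X 1 ^ k))
        - C l * (X 1 * (X 0 ^ (j + 1) * X 1 ^ k)) : MvPolynomial (Fin 2) ℂ)
        = C ((j + 1 : ℕ) : ℂ) * (X 0 ^ j * X 1 ^ k)
          - C (l + j + 1) * (X 0 ^ (j + 1) * X 1 ^ (k + 1)) by simp; ring]
      rw [map_sub, linearMap_C_mul, linearMap_C_mul, this]
      push_cast
      ring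
  simpa using LinearMap.congr_fun h f

/-- Integration by parts in the conjugate variable. -/
theorem pderiv_one_parts (hl : 0 < l.re) (hL : IsDiscFunctional l L)
    (f : MvPolynomial (Fin 2) ℂ) :
    L ((1 - X 0 * X 1) * pderiv 1 f - C l * (X 0 * f)) = 0 := by
  have h : L ∘ₗ (LinearMap.mulLeft ℂ (1 - X 0 * X 1) ∘ₗ (pderiv 1).toLinearMap
      - LinearMap.mulLeft ℂ (C l) ∘ₗ LinearMap.mulLeft ℂ (X 0)) = 0 := by
    refine linearMap_ext_X_pow fun j k => ?_
    change L ((1 - X 0 * X 1) * pderiv 1 (X 0 ^ j * X 1 ^ k)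
      - C l * (X 0 * (X 0 ^ j * X 1 ^ k))) = 0
    rw [pderiv_one_X_pow]
    rcases k with _ | k
    · have := hL.apply_of_ne (show j + 1 ≠ 0 by omega)
      rw [show ((1 - X 0 * X 1) * (C ((0 : ℕ) : ℂ) * (X 0 ^ j * X 1 ^ (0 - 1)))
        - C l * (X 0 * (X 0 ^ j * X 1 ^ 0)) : MvPolynomial (Fin 2) ℂ)
        = -(C l * (X 0 ^ (j + 1) * X 1 ^ 0)) by rw [Nat.cast_zero, C_0]; ring]
      rw [map_neg, linearMap_C_mul, this]; simp
    · have := apply_succ hl hL j k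
      rw [show ((1 - X 0 * X 1) * (C ((k + 1 : ℕ) : ℂ) * (X 0 ^ j * X 1 ^ (k + 1 - 1)))
        - C l * (X 0 * (X 0 ^ j * X 1 ^ (k + 1))) : MvPolynomial (Fin 2) ℂ)
        = C ((k + 1 : ℕ) : ℂ) * (X 0 ^ j * X 1 ^ k)
          - C (l + k + 1) * (X 0 ^ (j + 1) * X 1 ^ (k + 1)) by simp; ring]
      rw [map_sub, linearMap_C_mul, linearMap_C_mul]
      by_cases hjk : j = k
      · subst hjk
        rw [this]; push_cast; ring
      · rw [hL.apply_of_ne hjk, hL.apply_of_ne (show j + 1 ≠ k + 1 by omega)]; ring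
  simpa using LinearMap.congr_fun h f

end IsDiscFunctional

/-- The Euler derivation `w ∂ + w̄ ∂̄`. -/
noncomputable def eulerDeriv : Derivation ℂ (MvPolynomial (Fin 2) ℂ) (MvPolynomial (Fin 2) ℂ) :=
  (X 0 : MvPolynomial (Fin 2) ℂ) • pderiv 0 + (X 1 : MvPolynomial (Fin 2) ℂ) • pderiv 1

/-- The generator `w ∂ - w̄ ∂̄` of rotations. -/
noncomputable def rotationDeriv : Derivation ℂ (MvPolynomial (Fin 2) ℂ) (MvPolynomial (Fin 2) ℂ) :=
  (X 0 : MvPolynomial (Fin 2) ℂ) • pderiv 0 - (X 1 : MvPolynomial (Fin 2) ℂ) • pderiv 1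

theorem eulerDeriv_apply (f : MvPolynomial (Fin 2) ℂ) :
    eulerDeriv f = X 0 * pderiv 0 f + X 1 * pderiv 1 f := rfl

theorem rotationDeriv_apply (f : MvPolynomial (Fin 2) ℂ) :
    rotationDeriv f = X 0 * pderiv 0 f - X 1 * pderiv 1 f := rfl

/-- The second-order operator `4 ∂ ∂̄ - E² - 2 l E`, with `E` the Euler derivation. The orthogonal
polynomials of degree `n` on the disc are its eigenfunctions with eigenvalue `- n (n + 2 l)`. -/
noncomputable def discOperator (l : ℂ) (f : MvPolynomial (Fin 2) ℂ) : MvPolynomial (Fin 2) ℂ :=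
  4 * pderiv 0 (pderiv 1 f) - eulerDeriv (eulerDeriv f) - C (2 * l) * eulerDeriv f

theorem discOperator_X_pow (l : ℂ) (j k : ℕ) :
    discOperator l (X 0 ^ j * X 1 ^ k) =
      C (4 * j * k : ℂ) * (X 0 ^ (j - 1) * X 1 ^ (k - 1))
        - C (((j + k : ℕ) : ℂ) * ((j + k : ℕ) + 2 * l)) * (X 0 ^ j * X 1 ^ k) := by
  have hE : eulerDeriv (X 0 ^ j * X 1 ^ k) = C ((j : ℂ) + k) * (X 0 ^ j * X 1 ^ k) := by
    rw [eulerDeriv_apply, pderiv_zero_X_pow, pderiv_one_X_pow]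
    rcases j with _ | j <;> rcases k with _ | k <;> simp <;> ring
  have hE2 : eulerDeriv (C ((j : ℂ) + k) * (X 0 ^ j * X 1 ^ k))
      = C ((j : ℂ) + k) * (C ((j : ℂ) + k) * (X 0 ^ j * X 1 ^ k)) := by
    rw [derivation_C_mul, hE]
  rw [discOperator, hE, hE2, pderiv_one_X_pow, derivation_C_mul, pderiv_zero_X_pow]
  simp only [map_mul, map_add, map_ofNat, map_natCast, Nat.cast_add]
  ring

namespace IsDiscFunctional

variable {l : ℂ} {L : MvPolynomial (Fin 2) ℂ →ₗ[ℂ] ℂ}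

theorem apply_rotationDeriv (hL : IsDiscFunctional l L) (f : MvPolynomial (Fin 2) ℂ) :
    L (rotationDeriv f) = 0 := by
  have h : L ∘ₗ rotationDeriv.toLinearMap = 0 := by
    refine linearMap_ext_X_pow fun j k => ?_
    change L (rotationDeriv (X 0 ^ j * X 1 ^ k)) = 0
    have : rotationDeriv (X 0 ^ j * X 1 ^ k) = C ((j : ℂ) - k) * (X 0 ^ j * X 1 ^ k) := by
      rw [rotationDeriv_apply, pderiv_zero_X_pow, pderiv_one_X_pow]
      rcases j with _ | j <;> rcases k with _ | k <;> simp <;> ring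
    rw [this, linearMap_C_mul]
    by_cases hjk : j = k
    · simp [hjk]
    · rw [hL.apply_of_ne hjk, mul_zero]
  simpa using LinearMap.congr_fun h f

/-- The operator is the one of a symmetric Dirichlet form: in terms of the weight
`ω = (1 - |w|²)^(l - 1)`, it is `ω⁻¹ (2 ∂ (ω (1 - |w|²) ∂̄) + 2 ∂̄ (ω (1 - |w|²) ∂)) - (w ∂ - w̄ ∂̄)²`. -/
theorem apply_mul_discOperator (hl : 0 < l.re) (hL : IsDiscFunctional l L)
    (f g : MvPolynomial (Fin 2) ℂ) :
    L (g * discOperator l f) =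
      L (rotationDeriv g * rotationDeriv f
        - 2 * ((1 - X 0 * X 1) * (pderiv 0 g * pderiv 1 f + pderiv 1 g * pderiv 0 f))) := by
  have h0 := pderiv_zero_parts hl hL (g * pderiv 1 f)
  have h1 := pderiv_one_parts hl hL (g * pderiv 0 f)
  have hR := apply_rotationDeriv hL (g * rotationDeriv f)
  have hc := pderiv_zero_one_comm f
  have hid : g * discOperator l f =
      (rotationDeriv g * rotationDeriv f
        - 2 * ((1 - X 0 * X 1) * (pderiv 0 g * pderiv 1 f + pderiv 1 g * pderiv 0 f)))
      + C 2 * ((1 - X 0 * X 1) * pderiv 0 (g * pderiv 1 f) - C l * (X 1 * (g * pderiv 1 f)))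
      + C 2 * ((1 - X 0 * X 1) * pderiv 1 (g * pderiv 0 f) - C l * (X 0 * (g * pderiv 0 f)))
      - rotationDeriv (g * rotationDeriv f) := by
    simp only [discOperator, eulerDeriv_apply, rotationDeriv_apply, Derivation.leibniz, map_add,
      map_sub, smul_eq_mul, pderiv_X_self, pderiv_X_of_ne (show (1 : Fin 2) ≠ 0 by decide),
      pderiv_X_of_ne (show (0 : Fin 2) ≠ 1 by decide), map_mul, map_ofNat, hc]
    ring
  rw [hid, map_sub, map_add, map_add, linearMap_C_mul, linearMap_C_mul, h0, h1, hR]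
  ring

theorem discOperator_selfAdjoint (hl : 0 < l.re) (hL : IsDiscFunctional l L)
    (f g : MvPolynomial (Fin 2) ℂ) :
    L (g * discOperator l f) = L (f * discOperator l g) := by
  rw [apply_mul_discOperator hl hL f g, apply_mul_discOperator hl hL g f]
  refine congrArg L ?_
  ring

end IsDiscFunctional

/-- The linear form `(u w̄ + u⁻¹ w) / 2`. For `u = exp(i θ)` it is the coordinate of `w` in the
direction `θ`; for other nonzero `u` it is a coordinate in a complex direction. -/
noncomputable def ridgeCoord (u : ℂ) : MvPolynomial (Fin 2) ℂ :=
  C (u⁻¹ / 2) * X 0 + C (u / 2) * X 1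

theorem pderiv_zero_aeval_ridgeCoord (u : ℂ) (p : Polynomial ℂ) :
    pderiv 0 (Polynomial.aeval (ridgeCoord u) p)
      = C (u⁻¹ / 2) * Polynomial.aeval (ridgeCoord u) (Polynomial.derivative p) := by
  have h : pderiv 0 (ridgeCoord u) = C (u⁻¹ / 2) := by
    simp [ridgeCoord, Derivation.leibniz]
  rw [Derivation.map_aeval, h, smul_eq_mul, mul_comm]

theorem pderiv_one_aeval_ridgeCoord (u : ℂ) (p : Polynomial ℂ) :
    pderiv 1 (Polynomial.aeval (ridgeCoord u) p)
      = C (u / 2) * Polynomial.aeval (ridgeCoord u) (Polynomial.derivative p) := by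
  have h : pderiv 1 (ridgeCoord u) = C (u / 2) := by
    simp [ridgeCoord, Derivation.leibniz]
  rw [Derivation.map_aeval, h, smul_eq_mul, mul_comm]

theorem eulerDeriv_aeval_ridgeCoord (u : ℂ) (p : Polynomial ℂ) :
    eulerDeriv (Polynomial.aeval (ridgeCoord u) p)
      = Polynomial.aeval (ridgeCoord u) (Polynomial.X * Polynomial.derivative p) := by
  rw [eulerDeriv_apply, pderiv_zero_aeval_ridgeCoord, pderiv_one_aeval_ridgeCoord, map_mul,
    Polynomial.aeval_X]
  generalize Polynomial.aeval (ridgeCoord u) (Polynomial.derivative p) = q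
  rw [ridgeCoord]
  ring

theorem discOperator_gegenbauer (l : ℂ) {u : ℂ} (hu : u ≠ 0) (n : ℕ) :
    discOperator l (Polynomial.aeval (ridgeCoord u) (complexGegenbauer l n))
      = - C ((n : ℂ) * (n + 2 * l)) *
          Polynomial.aeval (ridgeCoord u) (complexGegenbauer l n) := by
  have hode := congrArg (Polynomial.aeval (ridgeCoord u)) (complexGegenbauer_ode l n)
  have h4 : (4 : MvPolynomial (Fin 2) ℂ) * (C (u / 2) * C (u⁻¹ / 2)) = 1 := by
    rw [show (4 : MvPolynomial (Fin 2) ℂ) = C 4 from (map_ofNat C 4).symm, ← C_mul, ← C_mul]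
    rw [show (4 * (u / 2 * (u⁻¹ / 2)) : ℂ) = 1 by field_simp; norm_num, C_1]
  rw [discOperator, pderiv_one_aeval_ridgeCoord, derivation_C_mul, pderiv_zero_aeval_ridgeCoord,
    eulerDeriv_aeval_ridgeCoord, eulerDeriv_aeval_ridgeCoord]
  simp only [Polynomial.derivative_mul, Polynomial.derivative_X, map_mul, map_add, map_sub, map_neg,
    map_pow, map_one, Polynomial.aeval_X, Polynomial.aeval_C, MvPolynomial.algebraMap_eq,
    map_natCast, map_ofNat] at hode ⊢
  linear_combination hode + Polynomial.aeval (ridgeCoord u)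
    (Polynomial.derivative (Polynomial.derivative (complexGegenbauer l n))) * h4

end DiscFunctional

/-! ### Orthogonality of ridge polynomials -/

section RidgeOrthogonality

open MvPolynomial

theorem ridgeCoord_pow (u : ℂ) (i : ℕ) :
    ridgeCoord u ^ i = ∑ m ∈ Finset.range (i + 1),
      C ((u⁻¹ / 2) ^ m * (u / 2) ^ (i - m) * i.choose m) * (X 0 ^ m * X 1 ^ (i - m)) := by
  rw [ridgeCoord, add_pow]
  refine Finset.sum_congr rfl fun m _ => ?_
  simp only [mul_pow, map_mul, map_pow, map_natCast]
  ring

namespace IsDiscFunctional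

variable {l : ℂ} {L : MvPolynomial (Fin 2) ℂ →ₗ[ℂ] ℂ}

/-- The ridge polynomial `C_n(ridgeCoord u)` is orthogonal to all monomials of smaller degree:
`discOperator` is symmetric, has the ridge polynomial as an eigenfunction, and is triangular on
monomials with diagonal entries different from that eigenvalue. -/
theorem gegenbauer_mul_X_pow_eq_zero (hl : 0 < l.re) (hL : IsDiscFunctional l L) {u : ℂ}
    (hu : u ≠ 0) (n j : ℕ) : ∀ k : ℕ, j + k < n →
    L (Polynomial.aeval (ridgeCoord u) (complexGegenbauer l n) * (X 0 ^ j * X 1 ^ k)) = 0 := by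
  induction j using Nat.strong_induction_on with
  | _ j ih =>
    intro k h
    have hs := discOperator_selfAdjoint hl hL (X 0 ^ j * X 1 ^ k)
      (Polynomial.aeval (ridgeCoord u) (complexGegenbauer l n))
    have h0 : (4 * j * k : ℂ) * L (Polynomial.aeval (ridgeCoord u) (complexGegenbauer l n)
        * (X 0 ^ (j - 1) * X 1 ^ (k - 1))) = 0 := by
      rcases Nat.eq_zero_or_pos j with rfl | hj
      · simp
      rcases Nat.eq_zero_or_pos k with rfl | hk
      · simp
      rw [ih (j - 1) (by omega) (k - 1) (by omega), mul_zero]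
    rw [discOperator_gegenbauer l hu, discOperator_X_pow] at hs
    set P := Polynomial.aeval (ridgeCoord u) (complexGegenbauer l n)
    have e : X 0 ^ j * X 1 ^ k * (-C ((n : ℂ) * (n + 2 * l)) * P)
        = C (-((n : ℂ) * (n + 2 * l))) * (P * (X 0 ^ j * X 1 ^ k)) := by rw [C_neg]; ring
    rw [mul_sub, map_sub, mul_left_comm, linearMap_C_mul, h0, mul_left_comm, linearMap_C_mul,
      e, linearMap_C_mul] at hs
    have hne : ((n : ℂ) - (j + k : ℕ)) * (n + (j + k : ℕ) + 2 * l) ≠ 0 := by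
      refine mul_ne_zero (sub_ne_zero.2 (by exact_mod_cast h.ne')) fun h' => ?_
      have := congrArg Complex.re h'
      simp at this
      have h1 : (0 : ℝ) ≤ n := n.cast_nonneg
      have h2 : (0 : ℝ) ≤ j := j.cast_nonneg
      have h3 : (0 : ℝ) ≤ k := k.cast_nonneg
      linarith
    apply (mul_eq_zero.1 _).resolve_left hne
    linear_combination hs

theorem gegenbauer_mul_aeval_eq_zero (hl : 0 < l.re) (hL : IsDiscFunctional l L) {u : ℂ}
    (hu : u ≠ 0) (v : ℂ) (n : ℕ) (p : Polynomial ℂ) (hp : p.natDegree < n) :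
    L (Polynomial.aeval (ridgeCoord u) (complexGegenbauer l n)
      * Polynomial.aeval (ridgeCoord v) p) = 0 := by
  rw [Polynomial.aeval_eq_sum_range' hp, Finset.mul_sum, map_sum]
  refine Finset.sum_eq_zero fun i hi => ?_
  rw [mul_smul_comm, map_smul, ridgeCoord_pow, Finset.mul_sum, map_sum, Finset.sum_eq_zero,
    smul_zero]
  intro m hm
  rw [Finset.mem_range] at hi hm
  rw [mul_left_comm, linearMap_C_mul, gegenbauer_mul_X_pow_eq_zero hl hL hu n m _ (by omega),
    mul_zero]

/-- Integration by parts along the direction in which `ridgeCoord u` is constant relates the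
top-degree moments of a ridge polynomial. -/
theorem gegenbauer_mul_X_pow_succ (hl : 0 < l.re) (hL : IsDiscFunctional l L) {u : ℂ}
    (hu : u ≠ 0) (k m : ℕ) :
    u⁻¹ * (l + m) * L (Polynomial.aeval (ridgeCoord u) (complexGegenbauer l (k + m + 1))
        * (X 0 ^ (k + 1) * X 1 ^ m))
      = u * (l + k) * L (Polynomial.aeval (ridgeCoord u) (complexGegenbauer l (k + m + 1))
        * (X 0 ^ k * X 1 ^ (m + 1))) := by
  have horth := gegenbauer_mul_X_pow_eq_zero hl hL hu (k + m + 1)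
  have hd0 := pderiv_zero_aeval_ridgeCoord u (complexGegenbauer l (k + m + 1))
  have hd1 := pderiv_one_aeval_ridgeCoord u (complexGegenbauer l (k + m + 1))
  set P := Polynomial.aeval (ridgeCoord u) (complexGegenbauer l (k + m + 1))
  set P' := Polynomial.aeval (ridgeCoord u)
    (Polynomial.derivative (complexGegenbauer l (k + m + 1)))
  have h0 := pderiv_zero_parts hl hL (P * (X 0 ^ k * X 1 ^ m))
  have h1 := pderiv_one_parts hl hL (P * (X 0 ^ k * X 1 ^ m))
  have hk : (k : ℂ) * L (P * (X 0 ^ (k - 1) * X 1 ^ m)) = 0 := by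
    rcases k with _ | k
    · simp
    · rw [Nat.add_sub_cancel, horth k m (by omega), mul_zero]
  have hm : (m : ℂ) * L (P * (X 0 ^ k * X 1 ^ (m - 1))) = 0 := by
    rcases m with _ | m
    · simp
    · rw [Nat.add_sub_cancel, horth k m (by omega), mul_zero]
  have huu : (C u * C (u⁻¹ / 2) : MvPolynomial (Fin 2) ℂ) = C u⁻¹ * C (u / 2) := by
    rw [← C_mul, ← C_mul]; congr 1; ring
  have e1 : C (k : ℂ) * (X 0 * X 0 ^ (k - 1)) = (C (k : ℂ) * X 0 ^ k : MvPolynomial (Fin 2) ℂ) := by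
    rcases k with _ | k
    · simp
    · rw [Nat.add_sub_cancel, pow_succ']
  have e2 : C (m : ℂ) * (X 1 * X 1 ^ (m - 1)) = (C (m : ℂ) * X 1 ^ m : MvPolynomial (Fin 2) ℂ) := by
    rcases m with _ | m
    · simp
    · rw [Nat.add_sub_cancel, pow_succ']
  -- the derivation `u ∂ - u⁻¹ ∂̄` kills `ridgeCoord u`, so `P'` drops out
  have hid : C u * ((1 - X 0 * X 1) * pderiv 0 (P * (X 0 ^ k * X 1 ^ m))
        - C l * (X 1 * (P * (X 0 ^ k * X 1 ^ m))))
      - C u⁻¹ * ((1 - X 0 * X 1) * pderiv 1 (P * (X 0 ^ k * X 1 ^ m))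
        - C l * (X 0 * (P * (X 0 ^ k * X 1 ^ m))))
      = C (u * k) * (P * (X 0 ^ (k - 1) * X 1 ^ m)) - C (u⁻¹ * m) * (P * (X 0 ^ k * X 1 ^ (m - 1)))
        - C (u * (l + k)) * (P * (X 0 ^ k * X 1 ^ (m + 1)))
        + C (u⁻¹ * (l + m)) * (P * (X 0 ^ (k + 1) * X 1 ^ m)) := by
    rw [Derivation.leibniz _ P, Derivation.leibniz _ P, pderiv_zero_X_pow, pderiv_one_X_pow, hd0, hd1]
    simp only [smul_eq_mul, C_mul, C_add, pow_succ]
    linear_combination (1 - X 0 * X 1) * X 0 ^ k * X 1 ^ m * P' * huu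
      - C u * P * X 1 ^ m * X 1 * e1 + C u⁻¹ * P * X 0 ^ k * X 0 * e2
  have hL' := congrArg L hid
  rw [map_sub, linearMap_C_mul, linearMap_C_mul, h0, h1, map_add, map_sub, map_sub,
    linearMap_C_mul, linearMap_C_mul, linearMap_C_mul, linearMap_C_mul] at hL'
  linear_combination -hL' - u * hk + u⁻¹ * hm

/-- The top-degree moments of a ridge polynomial, all expressed by the one against `w̄ ^ n`. -/
theorem gegenbauer_mul_X_pow_eq (hl : 0 < l.re) (hL : IsDiscFunctional l L) {u : ℂ}
    (hu : u ≠ 0) (k m : ℕ) :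
    (ascPochhammer ℂ (k + m)).eval l * L (Polynomial.aeval (ridgeCoord u)
        (complexGegenbauer l (k + m)) * (X 0 ^ k * X 1 ^ m))
      = u ^ (2 * k) * (ascPochhammer ℂ k).eval l * (ascPochhammer ℂ m).eval l *
        L (Polynomial.aeval (ridgeCoord u) (complexGegenbauer l (k + m))
          * (X 0 ^ 0 * X 1 ^ (k + m))) := by
  induction k generalizing m with
  | zero => simp
  | succ k ih =>
    have h1 := ih (m + 1)
    have h2 := gegenbauer_mul_X_pow_succ hl hL hu k m
    rw [show k + 1 + m = k + m + 1 by omega]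
    rw [show k + (m + 1) = k + m + 1 by omega] at h1
    apply mul_left_cancel₀ (mul_ne_zero (inv_ne_zero hu) (add_natCast_ne_zero_of_re_pos hl m))
    have e : u⁻¹ * u ^ 2 = u := by field_simp
    rw [ascPochhammer_succ_eval m] at h1
    rw [ascPochhammer_succ_eval k, show u ^ (2 * (k + 1)) = u ^ (2 * k) * u ^ 2 by ring]
    generalize L (Polynomial.aeval (ridgeCoord u) (complexGegenbauer l (k + m + 1))
        * (X 0 ^ 0 * X 1 ^ (k + m + 1))) = A at *
    generalize L (Polynomial.aeval (ridgeCoord u) (complexGegenbauer l (k + m + 1))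
        * (X 0 ^ (k + 1) * X 1 ^ m)) = B at *
    linear_combination (Polynomial.eval l (ascPochhammer ℂ (k + m + 1))) * h2 + u * (l + k) * h1
      - (l + m) * u ^ (2 * k) * Polynomial.eval l (ascPochhammer ℂ k) * (l + k)
        * Polynomial.eval l (ascPochhammer ℂ m) * A * e

/-- The moment against `w̄ ^ n` only sees the coefficient of `w ^ n`. -/
theorem gegenbauer_mul_X_one_pow (hl : 0 < l.re) (hL : IsDiscFunctional l L) (u : ℂ) (n : ℕ) :
    L (Polynomial.aeval (ridgeCoord u) (complexGegenbauer l n) * (X 0 ^ 0 * X 1 ^ n))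
      = u⁻¹ ^ n / (l + n) := by
  have hterm : ∀ i ≤ n, ∀ m ≤ i, m ≠ n →
      L (C ((u⁻¹ / 2) ^ m * (u / 2) ^ (i - m) * i.choose m) * (X 0 ^ m * X 1 ^ (i - m))
        * (X 0 ^ 0 * X 1 ^ n)) = 0 := by
    intro i hi m hm hmn
    rw [show (C ((u⁻¹ / 2) ^ m * (u / 2) ^ (i - m) * i.choose m) * (X 0 ^ m * X 1 ^ (i - m))
        * (X 0 ^ 0 * X 1 ^ n) : MvPolynomial (Fin 2) ℂ) = C ((u⁻¹ / 2) ^ m * (u / 2) ^ (i - m) * i.choose m)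
          * (X 0 ^ m * X 1 ^ (i - m + n)) by ring, linearMap_C_mul,
      hL.apply_of_ne (by omega), mul_zero]
  rw [Polynomial.aeval_eq_sum_range' (Nat.lt_succ_of_le (complexGegenbauer_natDegree_le l n)),
    Finset.sum_mul, map_sum, Finset.sum_eq_single n]
  · rw [smul_mul_assoc, map_smul, ridgeCoord_pow, Finset.sum_mul, map_sum,
      Finset.sum_eq_single n]
    · have hl0 := ascPochhammer_eval_ne_zero_of_re_pos hl n
      have hln := add_natCast_ne_zero_of_re_pos hl n
      have hf : (n.factorial : ℂ) ≠ 0 := by exact_mod_cast n.factorial_ne_zero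
      rw [mul_assoc, linearMap_C_mul, Nat.sub_self,
        show (X 0 ^ n * X 1 ^ 0 * (X 0 ^ 0 * X 1 ^ n) : MvPolynomial (Fin 2) ℂ)
          = X 0 ^ n * X 1 ^ n by ring, hL, if_pos rfl, complexGegenbauer_coeff_self,
        ascPochhammer_succ_eval, smul_eq_mul, Nat.choose_self, div_pow]
      push_cast
      field_simp
    · intro m hm hmn
      rw [Finset.mem_range] at hm
      exact hterm n le_rfl m (by omega) hmn
    · simp
  · intro i hi hin
    rw [Finset.mem_range] at hi
    rw [smul_mul_assoc, map_smul, ridgeCoord_pow, Finset.sum_mul, map_sum, Finset.sum_eq_zero,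
      smul_zero]
    intro m hm
    rw [Finset.mem_range] at hm
    exact hterm i (by omega) m (by omega) (by omega)
  · simp

/-- The reproducing property of ridge polynomials of equal degree. -/
theorem gegenbauer_mul_gegenbauer (hl : 0 < l.re) (hL : IsDiscFunctional l L) {u v : ℂ}
    (hu : u ≠ 0) (hv : v ≠ 0) (n : ℕ) :
    L (Polynomial.aeval (ridgeCoord u) (complexGegenbauer l n)
        * Polynomial.aeval (ridgeCoord v) (complexGegenbauer l n))
      = (complexGegenbauer l n).eval ((u / v + v / u) / 2) / (l + n) := by
  have hl0 := ascPochhammer_eval_ne_zero_of_re_pos hl n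
  have hf : (n.factorial : ℂ) ≠ 0 := by exact_mod_cast n.factorial_ne_zero
  have huv : u / v * (v / u) = 1 := by field_simp
  rw [complexGegenbauer_eval_joukowski l _ _ huv]
  conv_lhs => rw [Polynomial.aeval_eq_sum_range' (x := ridgeCoord v)
    (Nat.lt_succ_of_le (complexGegenbauer_natDegree_le l n))]
  rw [Finset.sum_range_succ, mul_add, map_add]
  -- only the leading term of the second factor contributes
  have hlow : L (Polynomial.aeval (ridgeCoord u) (complexGegenbauer l n)
      * ∑ i ∈ Finset.range n, (complexGegenbauer l n).coeff i • ridgeCoord v ^ i) = 0 := by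
    rw [Finset.mul_sum, map_sum]
    refine Finset.sum_eq_zero fun i hi => ?_
    have := gegenbauer_mul_aeval_eq_zero hl hL hu v n (Polynomial.X ^ i)
      (by rw [Polynomial.natDegree_X_pow]; exact Finset.mem_range.1 hi)
    rw [map_pow, Polynomial.aeval_X] at this
    rw [mul_smul_comm, map_smul, this, smul_zero]
  rw [hlow, zero_add, mul_smul_comm, map_smul, ridgeCoord_pow, Finset.mul_sum, map_sum,
    smul_eq_mul, Finset.mul_sum, Finset.sum_div]
  refine Finset.sum_congr rfl fun k hk => ?_
  obtain ⟨m, rfl⟩ := Nat.exists_eq_add_of_le (Nat.lt_succ_iff.1 (Finset.mem_range.1 hk))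
  have hA := gegenbauer_mul_X_pow_eq hl hL hu k m
  rw [gegenbauer_mul_X_one_pow hl hL] at hA
  rw [Nat.add_sub_cancel_left, mul_left_comm, linearMap_C_mul,
    eq_div_of_mul_eq hl0 ((mul_comm _ _).trans hA), complexGegenbauer_coeff_self,
    binomCoeff, binomCoeff, Nat.cast_add_choose]
  have hlkm := add_natCast_ne_zero_of_re_pos hl (k + m)
  have hfk : (k.factorial : ℂ) ≠ 0 := by exact_mod_cast k.factorial_ne_zero
  have hfm : (m.factorial : ℂ) ≠ 0 := by exact_mod_cast m.factorial_ne_zero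
  simp only [pow_add, div_pow, inv_pow, two_mul]
  field_simp

/-- Ridge polynomials of different degrees are orthogonal. -/
theorem gegenbauer_mul_gegenbauer_of_ne (hl : 0 < l.re) (hL : IsDiscFunctional l L) {u v : ℂ}
    (hu : u ≠ 0) (hv : v ≠ 0) {n m : ℕ} (hnm : n ≠ m) :
    L (Polynomial.aeval (ridgeCoord u) (complexGegenbauer l n)
        * Polynomial.aeval (ridgeCoord v) (complexGegenbauer l m)) = 0 := by
  rcases lt_or_gt_of_ne hnm with h | h
  · rw [mul_comm]
    exact gegenbauer_mul_aeval_eq_zero hl hL hv u m _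
      ((complexGegenbauer_natDegree_le l n).trans_lt h)
  · exact gegenbauer_mul_aeval_eq_zero hl hL hu v n _
      ((complexGegenbauer_natDegree_le l m).trans_lt h)

end IsDiscFunctional
end RidgeOrthogonality

/-! ### Integrals over the disc -/

section DiscIntegrals

open Metric Set

theorem radial_beta_integrand (j : ℕ) (α : ℂ) {y : ℝ} (hy : y ∈ Ioo (0 : ℝ) 1) :
    |2 * y| • (((y ^ 2 : ℝ) : ℂ) ^ (((j : ℂ) + 1) - 1) * (1 - ((y ^ 2 : ℝ) : ℂ)) ^ ((α + 1) - 1))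
      = (2 : ℝ) • (y ^ (2 - 1) • (((y ^ (2 * j) : ℝ) : ℂ) * ((1 - y ^ 2 : ℝ) : ℂ) ^ α)) := by
  rw [abs_of_nonneg (by linarith [hy.1]), add_sub_cancel_right, add_sub_cancel_right,
    Complex.cpow_natCast]
  simp only [Complex.real_smul]
  push_cast
  rw [pow_mul]
  ring

theorem image_sq_Ioo : (fun y : ℝ => y ^ 2) '' Ioo 0 1 = Ioo 0 1 := by
  ext x
  constructor
  · rintro ⟨y, hy, rfl⟩
    exact ⟨by have := hy.1; positivity, pow_lt_one₀ hy.1.le hy.2 two_ne_zero⟩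
  · intro hx
    refine ⟨√x, ⟨Real.sqrt_pos.2 hx.1, ?_⟩, Real.sq_sqrt hx.1.le⟩
    rw [← Real.sqrt_one]
    exact Real.sqrt_lt_sqrt hx.1.le hx.2

theorem injOn_sq_Ioo : InjOn (fun y : ℝ => y ^ 2) (Ioo 0 1) := fun _ hx _ hy h =>
  (pow_left_inj₀ hx.1.le hy.1.le two_ne_zero).1 h

theorem integrableOn_radial (j : ℕ) {α : ℂ} (hα : -1 < α.re) :
    IntegrableOn (fun y : ℝ => y ^ (2 - 1) • (((y ^ (2 * j) : ℝ) : ℂ) * ((1 - y ^ 2 : ℝ) : ℂ) ^ α))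
      (Ioo 0 1) := by
  have h := Complex.betaIntegral_convergent (u := (j : ℂ) + 1) (v := α + 1)
    (by simp; positivity) (by simp; linarith)
  rw [intervalIntegrable_iff_integrableOn_Ioo_of_le zero_le_one] at h
  have h2 := (integrableOn_image_iff_integrableOn_abs_deriv_smul (s := Ioo (0 : ℝ) 1)
    (f := fun y : ℝ => y ^ 2) (f' := fun y => 2 * y) measurableSet_Ioo
    (fun x _ => by simpa using (hasDerivAt_pow 2 x).hasDerivWithinAt) injOn_sq_Ioo
    (fun x : ℝ => (x : ℂ) ^ (((j : ℂ) + 1) - 1) * (1 - (x : ℂ)) ^ ((α + 1) - 1)))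
  rw [image_sq_Ioo] at h2
  have h3 := (integrableOn_congr_fun (fun y hy => radial_beta_integrand j α hy)
    measurableSet_Ioo).1 (h2.1 h)
  exact (integrable_smul_iff (two_ne_zero' ℝ) _).1 h3

theorem integral_radial (j : ℕ) (α : ℂ) :
    ∫ y in Ioo (0 : ℝ) 1, y ^ (2 - 1) • (((y ^ (2 * j) : ℝ) : ℂ) * ((1 - y ^ 2 : ℝ) : ℂ) ^ α)
      = Complex.betaIntegral ((j : ℂ) + 1) (α + 1) / 2 := by
  have h2 := (integral_image_eq_integral_abs_deriv_smul (s := Ioo (0 : ℝ) 1)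
    (f := fun y : ℝ => y ^ 2) (f' := fun y => 2 * y) measurableSet_Ioo
    (fun x _ => by simpa using (hasDerivAt_pow 2 x).hasDerivWithinAt) injOn_sq_Ioo
    (fun x : ℝ => (x : ℂ) ^ (((j : ℂ) + 1) - 1) * (1 - (x : ℂ)) ^ ((α + 1) - 1)))
  rw [image_sq_Ioo, setIntegral_congr_fun measurableSet_Ioo
    (fun y hy => radial_beta_integrand j α hy), integral_smul] at h2
  rw [Complex.betaIntegral, intervalIntegral.integral_of_le zero_le_one,
    integral_Ioc_eq_integral_Ioo, h2, Complex.real_smul]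
  push_cast
  ring

theorem integrableOn_disc_radial (j : ℕ) {α : ℂ} (hα : -1 < α.re) :
    IntegrableOn (fun w : ℂ => ((‖w‖ ^ (2 * j) : ℝ) : ℂ) * ((1 - ‖w‖ ^ 2 : ℝ) : ℂ) ^ α)
      (ball 0 1) := by
  rw [integrableOn_fun_norm_addHaar volume
    (f := fun y : ℝ => ((y ^ (2 * j) : ℝ) : ℂ) * ((1 - y ^ 2 : ℝ) : ℂ) ^ α),
    Complex.finrank_real_complex]
  exact integrableOn_radial j hα

theorem integral_disc_radial (j : ℕ) (α : ℂ) :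
    ∫ w in ball (0 : ℂ) 1, ((‖w‖ ^ (2 * j) : ℝ) : ℂ) * ((1 - ‖w‖ ^ 2 : ℝ) : ℂ) ^ α
      = Real.pi * Complex.betaIntegral ((j : ℂ) + 1) (α + 1) := by
  set f : ℝ → ℂ := fun y => ((y ^ (2 * j) : ℝ) : ℂ) * ((1 - y ^ 2 : ℝ) : ℂ) ^ α with hf
  have h1 : ∀ w : ℂ, (ball (0 : ℂ) 1).indicator (fun w => f ‖w‖) w
      = (Iio (1 : ℝ)).indicator f ‖w‖ := fun w => by
    simp [indicator]
  have h2 : ∀ y : ℝ, y ^ (2 - 1) • (Iio (1 : ℝ)).indicator f y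
      = (Iio (1 : ℝ)).indicator (fun y => y ^ (2 - 1) • f y) y := fun y => by
    by_cases hy : y < 1 <;> simp [indicator, hy]
  rw [← integral_indicator measurableSet_ball]
  change ∫ w, (ball (0 : ℂ) 1).indicator (fun w => f ‖w‖) w = _
  simp_rw [h1]
  rw [integral_fun_norm_addHaar, Complex.finrank_real_complex]
  simp_rw [h2]
  rw [setIntegral_indicator measurableSet_Iio, Ioi_inter_Iio, integral_radial,
    Measure.real, Complex.volume_ball]
  simp
  ring

theorem integrableOn_disc_mul_weight {α : ℂ} (hα : -1 < α.re) {φ : ℂ → ℂ} (hφ : Continuous φ) :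
    IntegrableOn (fun w : ℂ => φ w * ((1 - ‖w‖ ^ 2 : ℝ) : ℂ) ^ α) (ball 0 1) := by
  have h := integrableOn_disc_radial 0 hα
  simp only [mul_zero, pow_zero, Complex.ofReal_one, one_mul] at h
  obtain ⟨K, hK⟩ := (isCompact_closedBall (0 : ℂ) 1).exists_bound_of_continuousOn hφ.continuousOn
  refine Integrable.bdd_mul h hφ.aestronglyMeasurable (c := K) ?_
  filter_upwards [ae_restrict_mem measurableSet_ball] with w hw
  exact hK w (ball_subset_closedBall hw)

theorem integral_disc_monomial_of_ne (α : ℂ) {j k : ℕ} (hjk : j ≠ k) :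
    ∫ w in ball (0 : ℂ) 1, w ^ j * (starRingEnd ℂ) w ^ k * ((1 - ‖w‖ ^ 2 : ℝ) : ℂ) ^ α = 0 := by
  set F : ℂ → ℂ := fun w => w ^ j * (starRingEnd ℂ) w ^ k * ((1 - ‖w‖ ^ 2 : ℝ) : ℂ) ^ α
  -- the rotation by `π / (j - k)` changes the sign of the integrand
  set t : ℝ := Real.pi / ((j : ℝ) - k) with ht
  have h := (rotation (Circle.exp t)).measurePreserving.setIntegral_preimage_emb
    (rotation (Circle.exp t)).toHomeomorph.measurableEmbedding F (ball 0 1)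
  have hpre : (rotation (Circle.exp t)) ⁻¹' ball (0 : ℂ) 1 = ball 0 1 := by
    ext w
    rw [mem_preimage, mem_ball_zero_iff, mem_ball_zero_iff, LinearIsometryEquiv.norm_map]
  have hF : ∀ w, F (rotation (Circle.exp t) w) = -F w := by
    intro w
    have he : (Complex.exp (t * Complex.I)) ^ j * (Complex.exp (-(t * Complex.I))) ^ k = -1 := by
      rw [← Complex.exp_nat_mul, ← Complex.exp_nat_mul, ← Complex.exp_add, ← Complex.exp_pi_mul_I]
      congr 1
      have hne : (j : ℂ) - k ≠ 0 := sub_ne_zero.2 (by exact_mod_cast hjk)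
      rw [ht]
      push_cast
      field_simp
      ring
    have hc : (starRingEnd ℂ) (Complex.exp (t * Complex.I)) = Complex.exp (-(t * Complex.I)) := by
      rw [← Complex.exp_conj]
      simp
    simp only [F, rotation_apply, Circle.coe_exp, norm_mul, Complex.norm_exp_ofReal_mul_I, one_mul,
      map_mul, hc, mul_pow]
    linear_combination (w ^ j * (starRingEnd ℂ) w ^ k * ((1 - ‖w‖ ^ 2 : ℝ) : ℂ) ^ α) * he
  rw [hpre] at h
  simp_rw [hF] at h
  rw [integral_neg] at h
  exact self_eq_neg.1 h.symm

theorem continuous_aeval_conj (p : MvPolynomial (Fin 2) ℂ) :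
    Continuous fun w : ℂ => MvPolynomial.aeval ![w, (starRingEnd ℂ) w] p := by
  induction p using MvPolynomial.induction_on with
  | C r => simpa using continuous_const
  | add p q hp hq =>
    simp only [map_add]
    exact hp.add hq
  | mul_X p i hp =>
    simp only [map_mul, MvPolynomial.aeval_X]
    refine hp.mul ?_
    fin_cases i
    · exact continuous_id
    · exact Complex.continuous_conj

/-- The functional given by integration over the unit disc against `(1 - |w|²)^α d²w / π`. -/
noncomputable def discFunctional {α : ℂ} (hα : -1 < α.re) : MvPolynomial (Fin 2) ℂ →ₗ[ℂ] ℂ where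
  toFun p := (Real.pi : ℂ)⁻¹ * ∫ w in ball (0 : ℂ) 1,
    MvPolynomial.aeval ![w, (starRingEnd ℂ) w] p * ((1 - ‖w‖ ^ 2 : ℝ) : ℂ) ^ α
  map_add' p q := by
    simp only [map_add, add_mul]
    rw [integral_add (integrableOn_disc_mul_weight hα (continuous_aeval_conj p))
      (integrableOn_disc_mul_weight hα (continuous_aeval_conj q)), mul_add]
  map_smul' r p := by
    simp only [map_smul, smul_eq_mul, mul_assoc, integral_const_mul, RingHom.id_apply]
    ring

theorem ascPochhammer_eval_eq_prod (n : ℕ) (x : ℂ) :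
    (ascPochhammer ℂ n).eval x = ∏ j ∈ Finset.range n, (x + j) := by
  induction n with
  | zero => simp
  | succ n ih => rw [ascPochhammer_succ_eval, Finset.prod_range_succ, ih]

theorem isDiscFunctional_discFunctional {α : ℂ} (hα : -1 < α.re) :
    IsDiscFunctional (1 + α) (discFunctional hα) := by
  intro j k
  simp only [discFunctional, LinearMap.coe_mk, AddHom.coe_mk, map_mul, map_pow,
    MvPolynomial.aeval_X, Matrix.cons_val_zero, Matrix.cons_val_one]
  split_ifs with h
  · subst h
    have hw : ∀ w : ℂ, w ^ j * (starRingEnd ℂ) w ^ j = ((‖w‖ ^ (2 * j) : ℝ) : ℂ) := fun w => by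
      rw [← mul_pow, Complex.mul_conj, Complex.normSq_eq_norm_sq, pow_mul]
      push_cast
      rfl
    simp_rw [hw]
    have hpi : (Real.pi : ℂ) ≠ 0 := by exact_mod_cast Real.pi_ne_zero
    rw [integral_disc_radial, ← Complex.betaIntegral_symm, inv_mul_cancel_left₀ hpi,
      Complex.betaIntegral_eval_nat_add_one_right (by simp; linarith),
      ascPochhammer_eval_eq_prod, add_comm α 1]
  · rw [integral_disc_monomial_of_ne α h, mul_zero]

end DiscIntegrals

/-! ### Change of variables to the ellipse -/

section Ellipse

open Metric Set

/-- The linear parametrization `w ↦ a Re w + i b Im w` of the ellipse by the unit disc. -/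
noncomputable def ellipseParam (a b : ℝ) : ℂ →L[ℝ] ℂ :=
  Complex.reCLM.smulRight (a : ℂ) + Complex.imCLM.smulRight (b * Complex.I)

theorem ellipseParam_re (a b : ℝ) (w : ℂ) : (ellipseParam a b w).re = a * w.re := by
  simp [ellipseParam, mul_comm]

theorem ellipseParam_im (a b : ℝ) (w : ℂ) : (ellipseParam a b w).im = b * w.im := by
  simp [ellipseParam, mul_comm]

theorem ellipseParam_det (a b : ℝ) : (ellipseParam a b).det = a * b := by
  rw [ContinuousLinearMap.det, ← LinearMap.det_toMatrix Complex.basisOneI, Matrix.det_fin_two]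
  simp [LinearMap.toMatrix_apply, ellipseParam_re, ellipseParam_im]

variable {a b : ℝ}

theorem ellipseWeightBase_ellipseParam (ha : a ≠ 0) (hb : b ≠ 0) (w : ℂ) :
    ellipseWeightBase a b (ellipseParam a b w) = 1 - ‖w‖ ^ 2 := by
  rw [ellipseWeightBase, ellipseParam_re, ellipseParam_im, ← Complex.normSq_eq_norm_sq,
    Complex.normSq_apply]
  field_simp
  ring

theorem mem_ellipseInterior_iff {z : ℂ} :
    z ∈ ellipseInterior a b ↔ 0 < ellipseWeightBase a b z := by
  rw [ellipseInterior, ellipseWeightBase, mem_ofPred_eq]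
  constructor <;> intro h <;> linarith

theorem measurableSet_ellipseInterior : MeasurableSet (ellipseInterior a b) :=
  measurableSet_lt (by fun_prop) measurable_const

theorem ellipseParam_injective (ha : a ≠ 0) (hb : b ≠ 0) :
    Function.Injective (ellipseParam a b) := fun z w h => by
  have h1 := congrArg Complex.re h
  have h2 := congrArg Complex.im h
  rw [ellipseParam_re, ellipseParam_re] at h1
  rw [ellipseParam_im, ellipseParam_im] at h2
  exact Complex.ext (mul_left_cancel₀ ha h1) (mul_left_cancel₀ hb h2)

theorem image_ellipseParam_ball (ha : a ≠ 0) (hb : b ≠ 0) :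
    ellipseParam a b '' ball 0 1 = ellipseInterior a b := by
  have key : ∀ w : ℂ, ellipseParam a b w ∈ ellipseInterior a b ↔ w ∈ ball (0 : ℂ) 1 := fun w => by
    rw [mem_ellipseInterior_iff, ellipseWeightBase_ellipseParam ha hb, mem_ball_zero_iff, sub_pos,
      sq_lt_one_iff₀ (norm_nonneg w)]
  ext z
  constructor
  · rintro ⟨w, hw, rfl⟩
    exact (key w).2 hw
  · intro hz
    have hzw : ellipseParam a b ⟨z.re / a, z.im / b⟩ = z :=
      Complex.ext (by rw [ellipseParam_re]; field_simp) (by rw [ellipseParam_im]; field_simp)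
    exact ⟨_, (key _).1 (by rw [hzw]; exact hz), hzw⟩

theorem integrableOn_ellipseInterior_iff (ha : 0 < a) (hb : 0 < b) (F : ℂ → ℂ) :
    IntegrableOn F (ellipseInterior a b) ↔
      IntegrableOn (fun w => F (ellipseParam a b w)) (ball 0 1) := by
  rw [← image_ellipseParam_ball ha.ne' hb.ne',
    integrableOn_image_iff_integrableOn_abs_det_fderiv_smul volume measurableSet_ball
      (fun w _ => (ellipseParam a b).hasFDerivWithinAt)
      (ellipseParam_injective ha.ne' hb.ne').injOn, ellipseParam_det]
  exact integrable_smul_iff (abs_ne_zero.2 (mul_pos ha hb).ne') _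

theorem integral_ellipseInterior (ha : 0 < a) (hb : 0 < b) (F : ℂ → ℂ) :
    ∫ z in ellipseInterior a b, F z = (a * b : ℂ) * ∫ w in ball 0 1, F (ellipseParam a b w) := by
  rw [← image_ellipseParam_ball ha.ne' hb.ne',
    integral_image_eq_integral_abs_det_fderiv_smul volume measurableSet_ball
      (fun w _ => (ellipseParam a b).hasFDerivWithinAt)
      (ellipseParam_injective ha.ne' hb.ne').injOn, ellipseParam_det, integral_smul,
    abs_of_pos (mul_pos ha hb), Complex.real_smul]
  push_cast
  rfl

end Ellipse

/-! ### The rescaled Gegenbauer polynomials on the ellipse -/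

section ScaledGegenbauer

open Polynomial

/-- The rescaled monic Gegenbauer polynomials for a complex exponent `α`. -/
noncomputable def complexScaledGegenbauer (α : ℂ) (c : ℝ) (n : ℕ) : ℂ[X] :=
  C ((n.factorial : ℂ) * (c : ℂ) ^ n / (2 ^ n * (ascPochhammer ℂ n).eval (1 + α)))
    * (complexGegenbauer (1 + α) n).comp (C (c : ℂ)⁻¹ * X)

theorem ofReal_ascPochhammer_eval (n : ℕ) (x : ℝ) :
    (((ascPochhammer ℝ n).eval x : ℝ) : ℂ) = (ascPochhammer ℂ n).eval (x : ℂ) := by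
  induction n with
  | zero => simp
  | succ n ih => rw [ascPochhammer_succ_eval, ascPochhammer_succ_eval, ← ih]; push_cast; rfl

theorem scaledGegenbauerPoly_map_ofReal (α c : ℝ) (n : ℕ) :
    (scaledGegenbauerPoly α c n).map Complex.ofRealHom = complexScaledGegenbauer α c n := by
  rw [scaledGegenbauerPoly, complexScaledGegenbauer, Polynomial.map_mul, Polynomial.map_comp,
    gegenbauerPoly_map_ofReal]
  simp [ofReal_ascPochhammer_eval]

theorem complexScaledGegenbauer_natDegree_le (α : ℂ) (c : ℝ) (n : ℕ) :
    (complexScaledGegenbauer α c n).natDegree ≤ n := by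
  refine (natDegree_C_mul_le _ _).trans (natDegree_comp_le.trans ?_)
  calc _ ≤ n * 1 := Nat.mul_le_mul (complexGegenbauer_natDegree_le _ n)
        ((natDegree_C_mul_le _ _).trans natDegree_X_le)
    _ = n := mul_one n

theorem complexScaledGegenbauer_coeff_self {α : ℂ} (hα : -1 < α.re) {c : ℝ} (hc : c ≠ 0) (n : ℕ) :
    (complexScaledGegenbauer α c n).coeff n = 1 := by
  have h1 := ascPochhammer_eval_ne_zero_of_re_pos (l := 1 + α) (by simp; linarith) n
  have h2 : (n.factorial : ℂ) ≠ 0 := by exact_mod_cast n.factorial_ne_zero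
  have h3 : (c : ℂ) ≠ 0 := by exact_mod_cast hc
  rw [complexScaledGegenbauer, coeff_C_mul, comp_C_mul_X_coeff, complexGegenbauer_coeff_self,
    inv_pow]
  field_simp

theorem complexScaledGegenbauer_monic {α : ℂ} (hα : -1 < α.re) {c : ℝ} (hc : c ≠ 0) (n : ℕ) :
    (complexScaledGegenbauer α c n).Monic :=
  monic_of_natDegree_le_of_coeff_eq_one n (complexScaledGegenbauer_natDegree_le α c n)
    (complexScaledGegenbauer_coeff_self hα hc n)

theorem complexScaledGegenbauer_natDegree {α : ℂ} (hα : -1 < α.re) {c : ℝ} (hc : c ≠ 0) (n : ℕ) :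
    (complexScaledGegenbauer α c n).natDegree = n :=
  natDegree_eq_of_le_of_coeff_ne_zero (complexScaledGegenbauer_natDegree_le α c n)
    (by rw [complexScaledGegenbauer_coeff_self hα hc n]; exact one_ne_zero)

variable {a b : ℝ}

theorem ellipseFocus_sq (hb : 0 < b) (hab : b < a) : ellipseFocus a b ^ 2 = a ^ 2 - b ^ 2 :=
  Real.sq_sqrt (by nlinarith)

theorem ellipseFocus_pos (hb : 0 < b) (hab : b < a) : 0 < ellipseFocus a b :=
  Real.sqrt_pos.2 (by nlinarith)

/-- Up to the focal length `c`, the point `a Re w + i b Im w` of the ellipse is a coordinate of `w`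
in a complex direction. -/
theorem aeval_ridgeCoord (hb : 0 < b) (hab : b < a) (w : ℂ) :
    MvPolynomial.aeval ![w, (starRingEnd ℂ) w] (ridgeCoord ((a - b) / ellipseFocus a b))
      = (ellipseFocus a b : ℂ)⁻¹ * ellipseParam a b w := by
  have hc : (ellipseFocus a b : ℂ) ≠ 0 := by exact_mod_cast (ellipseFocus_pos hb hab).ne'
  have hc2 : (ellipseFocus a b : ℂ) ^ 2 = a ^ 2 - b ^ 2 := by exact_mod_cast ellipseFocus_sq hb hab
  have hne : (a : ℂ) - b ≠ 0 := by exact_mod_cast (sub_pos.2 hab).ne'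
  have hw : ellipseParam a b w
      = ((a + b) * w + (a - b) * (starRingEnd ℂ) w) / 2 := by
    apply Complex.ext
    · rw [ellipseParam_re]; simp; ring
    · rw [ellipseParam_im]; simp; ring
  rw [hw]
  simp only [ridgeCoord, map_add, map_mul, MvPolynomial.aeval_C, MvPolynomial.aeval_X,
    Matrix.cons_val_zero, Matrix.cons_val_one, Algebra.algebraMap_self, RingHom.id_apply, inv_div]
  field_simp
  linear_combination w * hc2

theorem complexScaledGegenbauer_eval_ellipseParam (hb : 0 < b) (hab : b < a) (α : ℂ) (n : ℕ)
    (w : ℂ) :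
    (complexScaledGegenbauer α (ellipseFocus a b) n).eval (ellipseParam a b w)
      = (n.factorial : ℂ) * (ellipseFocus a b : ℂ) ^ n / (2 ^ n * (ascPochhammer ℂ n).eval (1 + α))
        * MvPolynomial.aeval ![w, (starRingEnd ℂ) w]
          (aeval (ridgeCoord ((a - b) / ellipseFocus a b)) (complexGegenbauer (1 + α) n)) := by
  rw [complexScaledGegenbauer, eval_mul, eval_C, eval_comp, eval_mul, eval_C, eval_X,
    ← aeval_ridgeCoord hb hab, ← aeval_algHom_apply, coe_aeval_eq_eval]

theorem complexScaledGegenbauer_eval_conj_ellipseParam (hb : 0 < b) (hab : b < a) (α : ℂ) (n : ℕ)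
    (w : ℂ) :
    (complexScaledGegenbauer α (ellipseFocus a b) n).eval ((starRingEnd ℂ) (ellipseParam a b w))
      = (n.factorial : ℂ) * (ellipseFocus a b : ℂ) ^ n / (2 ^ n * (ascPochhammer ℂ n).eval (1 + α))
        * MvPolynomial.aeval ![w, (starRingEnd ℂ) w]
          (aeval (ridgeCoord ((a + b) / ellipseFocus a b)) (complexGegenbauer (1 + α) n)) := by
  have h1 : (starRingEnd ℂ) (ellipseParam a b w) = ellipseParam a b ((starRingEnd ℂ) w) := by
    apply Complex.ext <;> simp [ellipseParam_re, ellipseParam_im]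
  have h2 : MvPolynomial.aeval ![w, (starRingEnd ℂ) w] (ridgeCoord ((a + b) / ellipseFocus a b))
      = MvPolynomial.aeval ![(starRingEnd ℂ) w, (starRingEnd ℂ) ((starRingEnd ℂ) w)]
          (ridgeCoord ((a - b) / ellipseFocus a b)) := by
    have hc : (ellipseFocus a b : ℂ) ≠ 0 := by exact_mod_cast (ellipseFocus_pos hb hab).ne'
    have hc2 : (ellipseFocus a b : ℂ) ^ 2 = a ^ 2 - b ^ 2 := by
      exact_mod_cast ellipseFocus_sq hb hab
    have hne : (a : ℂ) - b ≠ 0 := by exact_mod_cast (sub_pos.2 hab).ne'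
    have hne' : (a : ℂ) + b ≠ 0 := by exact_mod_cast (add_pos (hb.trans hab) hb).ne'
    simp only [ridgeCoord, map_add, map_mul, MvPolynomial.aeval_C, MvPolynomial.aeval_X,
      Matrix.cons_val_zero, Matrix.cons_val_one, Algebra.algebraMap_self, RingHom.id_apply, inv_div,
      Complex.conj_conj]
    field_simp
    linear_combination ((a - b) * w - (a + b) * (starRingEnd ℂ) w) * hc2
  rw [h1, complexScaledGegenbauer_eval_ellipseParam hb hab, ← aeval_algHom_apply,
    ← aeval_algHom_apply, h2]

/-- The squared norm of the rescaled Gegenbauer polynomial of degree `n` for the weight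
`(1 - h(z))^α d²z / (π a b)`. -/
noncomputable def gegenbauerSqNorm (a b : ℝ) (α : ℂ) (n : ℕ) : ℂ :=
  ((n.factorial : ℂ) * (ellipseFocus a b : ℂ) ^ n / (2 ^ n * (ascPochhammer ℂ n).eval (1 + α))) ^ 2
    * ((complexGegenbauer (1 + α) n).eval (((a : ℂ) ^ 2 + b ^ 2) / (a ^ 2 - b ^ 2)) / (1 + α + n))

/-- The pairing `p_n(z) p_m(z̄)` against the weight. For complex `α` this bilinear version, and not
the Hermitian one, is the analytic continuation from real `α`. -/
noncomputable def complexGegenbauerPairing (a b : ℝ) (α : ℂ) (n m : ℕ) (z : ℂ) : ℂ :=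
  (complexScaledGegenbauer α (ellipseFocus a b) n).eval z
    * (complexScaledGegenbauer α (ellipseFocus a b) m).eval ((starRingEnd ℂ) z)
    * ((ellipseWeightBase a b z : ℂ) ^ α / ((Real.pi * a * b : ℝ) : ℂ))

theorem complexGegenbauerPairing_ellipseParam (hb : 0 < b) (hab : b < a) (α : ℂ) (n m : ℕ)
    (w : ℂ) :
    complexGegenbauerPairing a b α n m (ellipseParam a b w)
      = ((n.factorial : ℂ) * (ellipseFocus a b : ℂ) ^ n
          / (2 ^ n * (ascPochhammer ℂ n).eval (1 + α)))
        * ((m.factorial : ℂ) * (ellipseFocus a b : ℂ) ^ m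
          / (2 ^ m * (ascPochhammer ℂ m).eval (1 + α))) / ((Real.pi * a * b : ℝ) : ℂ)
        * (MvPolynomial.aeval ![w, (starRingEnd ℂ) w]
            (aeval (ridgeCoord ((a - b) / ellipseFocus a b)) (complexGegenbauer (1 + α) n)
              * aeval (ridgeCoord ((a + b) / ellipseFocus a b)) (complexGegenbauer (1 + α) m))
          * ((1 - ‖w‖ ^ 2 : ℝ) : ℂ) ^ α) := by
  rw [complexGegenbauerPairing, complexScaledGegenbauer_eval_ellipseParam hb hab,
    complexScaledGegenbauer_eval_conj_ellipseParam hb hab,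
    ellipseWeightBase_ellipseParam (hb.trans hab).ne' hb.ne', map_mul]
  ring

theorem integrableOn_complexGegenbauerPairing (hb : 0 < b) (hab : b < a) {α : ℂ} (hα : -1 < α.re)
    (n m : ℕ) : IntegrableOn (complexGegenbauerPairing a b α n m) (ellipseInterior a b) := by
  rw [integrableOn_ellipseInterior_iff (hb.trans hab) hb]
  simp_rw [complexGegenbauerPairing_ellipseParam hb hab]
  exact (integrableOn_disc_mul_weight hα (continuous_aeval_conj _)).const_mul _

theorem integral_complexGegenbauerPairing (hb : 0 < b) (hab : b < a) {α : ℂ} (hα : -1 < α.re)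
    (n m : ℕ) : ∫ z in ellipseInterior a b, complexGegenbauerPairing a b α n m z
      = if n = m then gegenbauerSqNorm a b α n else 0 := by
  have ha : 0 < a := hb.trans hab
  have hl : 0 < (1 + α).re := by simp; linarith
  have hL := isDiscFunctional_discFunctional hα
  have hc : (ellipseFocus a b : ℂ) ≠ 0 := by exact_mod_cast (ellipseFocus_pos hb hab).ne'
  have hne : (a : ℂ) - b ≠ 0 := by exact_mod_cast (sub_pos.2 hab).ne'
  have hne' : (a : ℂ) + b ≠ 0 := by exact_mod_cast (add_pos ha hb).ne'
  have hu := div_ne_zero hne hc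
  have hv := div_ne_zero hne' hc
  have hpi : (Real.pi : ℂ) ≠ 0 := by exact_mod_cast Real.pi_ne_zero
  have ha' : (a : ℂ) ≠ 0 := by exact_mod_cast ha.ne'
  have hb' : (b : ℂ) ≠ 0 := by exact_mod_cast hb.ne'
  rw [integral_ellipseInterior ha hb]
  simp_rw [complexGegenbauerPairing_ellipseParam hb hab]
  rw [integral_const_mul]
  have hdisc : ∀ p, ∫ w in Metric.ball (0 : ℂ) 1,
      MvPolynomial.aeval ![w, (starRingEnd ℂ) w] p * ((1 - ‖w‖ ^ 2 : ℝ) : ℂ) ^ α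
        = Real.pi * discFunctional hα p := fun p => by
    simp only [discFunctional, LinearMap.coe_mk, AddHom.coe_mk]
    rw [mul_inv_cancel_left₀ hpi]
  rw [hdisc]
  split_ifs with h
  · subst h
    rw [hL.gegenbauer_mul_gegenbauer hl hu hv, gegenbauerSqNorm]
    have hx : (((a : ℂ) - b) / ellipseFocus a b / ((a + b) / ellipseFocus a b)
        + (a + b) / ellipseFocus a b / ((a - b) / ellipseFocus a b)) / 2
        = ((a : ℂ) ^ 2 + b ^ 2) / (a ^ 2 - b ^ 2) := by
      have h2 : (a : ℂ) ^ 2 - b ^ 2 ≠ 0 := by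
        rw [sq_sub_sq]; exact mul_ne_zero hne' hne
      rw [sq_sub_sq] at *
      field_simp
      ring
    rw [hx]
    push_cast
    field_simp
  · rw [hL.gegenbauer_mul_gegenbauer_of_ne hl hu hv h]
    simp

theorem Gamma_add_natCast {s : ℂ} (hs : 0 < s.re) (n : ℕ) :
    Complex.Gamma (s + n) = (ascPochhammer ℂ n).eval s * Complex.Gamma s := by
  induction n with
  | zero => simp
  | succ n ih =>
    rw [ascPochhammer_succ_eval, Nat.cast_add, Nat.cast_one, ← add_assoc,
      Complex.Gamma_add_one _ (add_natCast_ne_zero_of_re_pos hs n), ih]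
    ring

/-- The norms in terms of Gamma functions, by the duplication formula for `Γ(2 + 2 α)`. -/
theorem gegenbauerSqNorm_eq (hb : 0 < b) (hab : b < a) {α : ℂ} (hα : -1 < α.re) (n : ℕ) :
    gegenbauerSqNorm a b α n
      = ((ellipseFocus a b : ℂ) / 2) ^ (2 * n)
        * (((Real.sqrt Real.pi : ℝ) : ℂ) * Complex.Gamma (1 + α)
          / ((2 : ℂ) ^ (2 * α + 1) * Complex.Gamma (α + 3 / 2)))
        * (Complex.Gamma (2 + 2 * α + n) * Complex.Gamma ((n : ℂ) + 1)
            / (Complex.Gamma (1 + α + n) * Complex.Gamma (2 + α + n))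
          * ordinaryHypergeometric (2 + 2 * α + (n : ℂ)) (-(n : ℂ)) (α + 3 / 2)
              (-(b : ℂ) ^ 2 / (ellipseFocus a b : ℂ) ^ 2)) := by
  have hl : 0 < (1 + α).re := by simp; linarith
  have hc : (ellipseFocus a b : ℂ) ≠ 0 := by exact_mod_cast (ellipseFocus_pos hb hab).ne'
  have hc2 : (a : ℂ) ^ 2 - b ^ 2 = (ellipseFocus a b : ℂ) ^ 2 := by
    exact_mod_cast (ellipseFocus_sq hb hab).symm
  have hx : ((a : ℂ) ^ 2 + b ^ 2) / (a ^ 2 - b ^ 2)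
      = 1 - 2 * (-(b : ℂ) ^ 2 / (ellipseFocus a b : ℂ) ^ 2) := by
    rw [hc2]
    field_simp
    linear_combination hc2
  rw [gegenbauerSqNorm, hx, complexGegenbauer_eval_eq_hypergeometric _ hl,
    show 2 * (1 + α) + (n : ℂ) = 2 + 2 * α + n by ring, show 1 + α + 1 / 2 = α + 3 / 2 by ring]
  have hdup := Complex.Gamma_mul_Gamma_add_half (1 + α)
  rw [show 1 + α + 1 / 2 = α + 3 / 2 by ring, show 2 * (1 + α) = 2 + 2 * α by ring] at hdup
  have h2l : 0 < (2 + 2 * α).re := by simp; linarith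
  have h2pow : (2 : ℂ) ^ (1 - (2 + 2 * α)) * 2 ^ (2 * α + 1) = 1 := by
    rw [← Complex.cpow_add _ _ two_ne_zero]
    ring_nf
    simp
  have hG1 := Complex.Gamma_ne_zero_of_re_pos hl
  have hG3 : Complex.Gamma (α + 3 / 2) ≠ 0 := Complex.Gamma_ne_zero_of_re_pos (by simp; linarith)
  have hP := ascPochhammer_eval_ne_zero_of_re_pos hl n
  have hln := add_natCast_ne_zero_of_re_pos hl n
  have hf : (n.factorial : ℂ) ≠ 0 := by exact_mod_cast n.factorial_ne_zero
  have h2 : (2 : ℂ) ^ (2 * α + 1) ≠ 0 := by simp [Complex.cpow_eq_zero_iff]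
  rw [show 2 + α + (n : ℂ) = (1 + α + n) + 1 by ring, Complex.Gamma_add_one _ hln,
    Gamma_add_natCast hl, Gamma_add_natCast h2l, Complex.Gamma_nat_eq_factorial,
    show 2 * (1 + α) = 2 + 2 * α by ring]
  have hdup' : Complex.Gamma (2 + 2 * α) * ((Real.sqrt Real.pi : ℝ) : ℂ)
      = Complex.Gamma (1 + α) * Complex.Gamma (α + 3 / 2) * 2 ^ (2 * α + 1) := by
    linear_combination (-(2 : ℂ) ^ (2 * α + 1)) * hdup
      - Complex.Gamma (2 + 2 * α) * ((Real.sqrt Real.pi : ℝ) : ℂ) * h2pow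
  generalize ordinaryHypergeometric (2 + 2 * α + (n : ℂ)) (-(n : ℂ)) (α + 3 / 2)
              (-(b : ℂ) ^ 2 / (ellipseFocus a b : ℂ) ^ 2) = F
  generalize ((Real.sqrt Real.pi : ℝ) : ℂ) = s at *
  have hG2 := Complex.Gamma_ne_zero_of_re_pos h2l
  rw [eq_div_of_mul_eq hG2 ((mul_comm _ _).trans hdup')]
  have hpow : ((ellipseFocus a b : ℂ) / 2) ^ (2 * n) = ((ellipseFocus a b : ℂ) ^ n / 2 ^ n) ^ 2 := by
    rw [mul_comm, pow_mul, div_pow]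
  rw [hpow]
  generalize (2 : ℂ) ^ (2 * α + 1) = t at *
  generalize Complex.Gamma (α + 3 / 2) = G3 at *
  generalize Complex.Gamma (2 + 2 * α) = G2 at *
  field_simp

end ScaledGegenbauer

/-! ### Andréief's identity and the Selberg integral -/

section Andreief

/-- Andréief's identity for biorthogonal families, with absolute convergence. -/
theorem integral_det_mul_det {E : Type*} [MeasurableSpace E] {μ : Measure E} [SigmaFinite μ]
    {N : ℕ} (f g : Fin N → E → ℂ) (W : E → ℂ) (h : Fin N → ℂ)
    (hint : ∀ j k, Integrable (fun x => f j x * g k x * W x) μ)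
    (horth : ∀ j k, ∫ x, f j x * g k x * W x ∂μ = if j = k then h j else 0) :
    Integrable (fun x : Fin N → E => (Matrix.of fun i j => f j (x i)).det
        * (Matrix.of fun i j => g j (x i)).det * ∏ i, W (x i)) (Measure.pi fun _ => μ) ∧
      ∫ x : Fin N → E, (Matrix.of fun i j => f j (x i)).det
        * (Matrix.of fun i j => g j (x i)).det * ∏ i, W (x i) ∂(Measure.pi fun _ => μ)
        = N.factorial * ∏ j, h j := by
  have hexp : (fun x : Fin N → E => (Matrix.of fun i j => f j (x i)).det
        * (Matrix.of fun i j => g j (x i)).det * ∏ i, W (x i))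
      = fun x => ∑ σ : Equiv.Perm (Fin N), ∑ τ : Equiv.Perm (Fin N),
          (((Equiv.Perm.sign σ : ℤ) : ℂ) * ((Equiv.Perm.sign τ : ℤ) : ℂ))
            * ∏ i, (f (σ i) (x i) * g (τ i) (x i) * W (x i)) := by
    funext x
    rw [← Matrix.det_transpose, ← Matrix.det_transpose (Matrix.of fun i j => g j (x i)),
      Matrix.det_apply', Matrix.det_apply', Finset.sum_mul_sum, Finset.sum_mul]
    refine Finset.sum_congr rfl fun σ _ => ?_
    rw [Finset.sum_mul]
    refine Finset.sum_congr rfl fun τ _ => ?_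
    simp only [Matrix.transpose_apply, Matrix.of_apply, Finset.prod_mul_distrib]
    ring
  have hterm : ∀ σ τ : Equiv.Perm (Fin N), Integrable (fun x : Fin N → E =>
      (((Equiv.Perm.sign σ : ℤ) : ℂ) * ((Equiv.Perm.sign τ : ℤ) : ℂ))
            * ∏ i, (f (σ i) (x i) * g (τ i) (x i) * W (x i))) (Measure.pi fun _ => μ) :=
    fun σ τ => (Integrable.fintype_prod (f := fun i x => f (σ i) x * g (τ i) x * W x)
      fun i => hint (σ i) (τ i)).const_mul _
  rw [hexp]
  refine ⟨integrable_finsetSum _ fun σ _ => integrable_finsetSum _ fun τ _ => hterm σ τ, ?_⟩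
  rw [integral_finsetSum _ fun σ _ => integrable_finsetSum _ fun τ _ => hterm σ τ]
  have hval : ∀ σ : Equiv.Perm (Fin N), ∫ x : Fin N → E, ∑ τ : Equiv.Perm (Fin N),
      (((Equiv.Perm.sign σ : ℤ) : ℂ) * ((Equiv.Perm.sign τ : ℤ) : ℂ))
            * ∏ i, (f (σ i) (x i) * g (τ i) (x i) * W (x i)) ∂(Measure.pi fun _ => μ)
      = ∏ j, h j := by
    intro σ
    rw [integral_finsetSum _ fun τ _ => hterm σ τ, Finset.sum_eq_single σ]
    · rw [integral_const_mul,
        integral_fintype_prod_eq_prod (fun i x => f (σ i) x * g (σ i) x * W x)]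
      simp only [horth, if_true]
      rw [Equiv.prod_comp σ h, ← Int.cast_mul, Int.units_coe_mul_self]
      simp
    · intro τ _ hτ
      obtain ⟨i, hi⟩ : ∃ i, σ i ≠ τ i := by
        by_contra! hcon
        exact hτ (Equiv.ext fun i => (hcon i).symm)
      rw [integral_const_mul,
        integral_fintype_prod_eq_prod (fun i x => f (σ i) x * g (τ i) x * W x),
        Finset.prod_eq_zero (Finset.mem_univ i), mul_zero]
      rw [horth, if_neg hi]
    · simp
  simp only [hval, Finset.sum_const, Finset.card_univ, Fintype.card_perm, Fintype.card_fin,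
    nsmul_eq_mul]

end Andreief

section Selberg

variable {a b : ℝ}

theorem vandermondeProduct_eq_det {N : ℕ} (z : Fin N → ℂ) :
    vandermondeProduct z = (Matrix.vandermonde z).det := by
  rw [Matrix.det_vandermonde, vandermondeProduct]
  exact Finset.prod_comm' (by simp)

theorem conj_vandermondeProduct {N : ℕ} (z : Fin N → ℂ) :
    (starRingEnd ℂ) (vandermondeProduct z) = vandermondeProduct fun i => (starRingEnd ℂ) (z i) := by
  simp [vandermondeProduct, map_prod]

theorem vandermondeProduct_eq_det_gegenbauer (hb : 0 < b) (hab : b < a) {α : ℂ} (hα : -1 < α.re)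
    {N : ℕ} (z : Fin N → ℂ) :
    vandermondeProduct z = (Matrix.of fun i j : Fin N =>
      (complexScaledGegenbauer α (ellipseFocus a b) j).eval (z i)).det := by
  have hc := (ellipseFocus_pos hb hab).ne'
  rw [vandermondeProduct_eq_det]
  exact Matrix.det_eval_matrixOfPolynomials_eq_det_vandermonde z _
    (fun i => complexScaledGegenbauer_natDegree hα hc i)
    (fun i => complexScaledGegenbauer_monic hα hc i)

theorem selbergIntegrandComplex_eq (hb : 0 < b) (hab : b < a) {α : ℂ} (hα : -1 < α.re) {N : ℕ}
    (z : Fin N → ℂ) :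
    selbergIntegrandComplex a b α N z =
      (Matrix.of fun i j : Fin N =>
        (complexScaledGegenbauer α (ellipseFocus a b) j).eval (z i)).det
      * (Matrix.of fun i j : Fin N =>
        (complexScaledGegenbauer α (ellipseFocus a b) j).eval ((starRingEnd ℂ) (z i))).det
      * ∏ i, ((ellipseWeightBase a b (z i) : ℂ) ^ α / ((Real.pi * a * b : ℝ) : ℂ)) := by
  rw [selbergIntegrandComplex, ← Complex.normSq_eq_norm_sq, ← Complex.mul_conj,
    conj_vandermondeProduct, vandermondeProduct_eq_det_gegenbauer hb hab hα z,
    vandermondeProduct_eq_det_gegenbauer hb hab hα fun i => (starRingEnd ℂ) (z i)]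

theorem volume_restrict_ellipsePower (a b : ℝ) (N : ℕ) :
    (volume : Measure (Fin N → ℂ)).restrict (ellipsePower a b N)
      = Measure.pi fun _ => volume.restrict (ellipseInterior a b) := by
  rw [ellipsePower, volume_pi, Measure.restrict_pi_pi]

theorem selbergIntegralComplex (hb : 0 < b) (hab : b < a) {α : ℂ} (hα : -1 < α.re) (N : ℕ) :
    IntegrableOn (selbergIntegrandComplex a b α N) (ellipsePower a b N) ∧
      ∫ z in ellipsePower a b N, selbergIntegrandComplex a b α N z
        = N.factorial * ∏ n ∈ Finset.range N, gegenbauerSqNorm a b α n := by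
  have h := integral_det_mul_det (μ := volume.restrict (ellipseInterior a b))
    (fun (j : Fin N) z => (complexScaledGegenbauer α (ellipseFocus a b) j).eval z)
    (fun (j : Fin N) z => (complexScaledGegenbauer α (ellipseFocus a b) j).eval ((starRingEnd ℂ) z))
    (fun z => (ellipseWeightBase a b z : ℂ) ^ α / ((Real.pi * a * b : ℝ) : ℂ))
    (fun j => gegenbauerSqNorm a b α j)
    (fun j k => integrableOn_complexGegenbauerPairing hb hab hα j k)
    (fun j k => by
      have := integral_complexGegenbauerPairing hb hab hα j k
      simp only [Fin.val_inj] at this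
      exact this)
  rw [IntegrableOn, volume_restrict_ellipsePower, funext (selbergIntegrandComplex_eq hb hab hα),
    Finset.prod_range]
  exact h

theorem selbergClosedFormComplex_eq (hb : 0 < b) (hab : b < a) {α : ℂ} (hα : -1 < α.re) (N : ℕ) :
    selbergClosedFormComplex a b N α
      = N.factorial * ∏ n ∈ Finset.range N, gegenbauerSqNorm a b α n := by
  have h1 : (Real.pi : ℂ) ^ ((N : ℂ) / 2) = ((Real.sqrt Real.pi : ℝ) : ℂ) ^ N := by
    rw [Real.sqrt_eq_rpow, Complex.ofReal_cpow Real.pi_pos.le, ← Complex.cpow_nat_mul]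
    congr 1
    push_cast
    ring
  have h2 : (2 : ℂ) ^ ((2 * α + 1) * N) = ((2 : ℂ) ^ (2 * α + 1)) ^ N := by
    rw [← Complex.cpow_nat_mul, mul_comm]
  have h3 : ∏ n ∈ Finset.range N, ((ellipseFocus a b : ℂ) / 2) ^ (2 * n)
      = ((ellipseFocus a b : ℂ) / 2) ^ (N * (N - 1)) := by
    rw [Finset.prod_pow_eq_pow_sum, ← Finset.mul_sum, mul_comm 2, Finset.sum_range_id_mul_two]
  rw [selbergClosedFormComplex, Finset.prod_congr rfl fun n _ => gegenbauerSqNorm_eq hb hab hα n]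
  simp only [Finset.prod_mul_distrib, Finset.prod_const, Finset.card_range]
  rw [h3, h1, h2, div_pow (_ * _), mul_pow, mul_pow]
  ring

theorem differentiable_complexGegenbauer_eval (n : ℕ) (x : ℂ) :
    Differentiable ℂ fun α : ℂ => (complexGegenbauer (1 + α) n).eval x := by
  induction n using Nat.twoStepInduction with
  | zero => simp [complexGegenbauer]
  | one =>
    simp only [complexGegenbauer, Polynomial.eval_mul, Polynomial.eval_C, Polynomial.eval_X]
    fun_prop
  | more n h0 h1 =>
    simp only [complexGegenbauer, Polynomial.eval_mul, Polynomial.eval_C, Polynomial.eval_X,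
      Polynomial.eval_sub]
    fun_prop

theorem differentiableOn_gegenbauerSqNorm (a b : ℝ) (n : ℕ) :
    DifferentiableOn ℂ (fun α => gegenbauerSqNorm a b α n) {α : ℂ | -1 < α.re} := by
  intro α hα
  have hl : 0 < (1 + α).re := by
    have : -1 < α.re := hα
    simp; linarith
  have h1 := ascPochhammer_eval_ne_zero_of_re_pos hl n
  have h2 := add_natCast_ne_zero_of_re_pos hl n
  have h3 : (2 : ℂ) ^ n ≠ 0 := pow_ne_zero _ two_ne_zero
  have h4 : DifferentiableAt ℂ (fun α : ℂ => (ascPochhammer ℂ n).eval (1 + α)) α := by fun_prop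
  refine DifferentiableAt.differentiableWithinAt ?_
  unfold gegenbauerSqNorm
  refine DifferentiableAt.mul (DifferentiableAt.pow (DifferentiableAt.div ?_ ?_ ?_) 2)
    (DifferentiableAt.div (differentiable_complexGegenbauer_eval n _ α) (by fun_prop) h2)
  · exact differentiableAt_const _
  · exact (differentiableAt_const _).mul h4
  · exact mul_ne_zero h3 h1

theorem meromorphic_selbergClosedFormComplex (a b : ℝ) (N : ℕ) :
    Meromorphic (selbergClosedFormComplex a b N) := by
  intro α
  have hdiff : ∀ {f : ℂ → ℂ}, Differentiable ℂ f → MeromorphicAt f α :=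
    fun hf => (hf.analyticAt α).meromorphicAt
  have hGamma : ∀ {f : ℂ → ℂ}, Differentiable ℂ f →
      MeromorphicAt (fun α => Complex.Gamma (f α)) α :=
    fun hf => (Meromorphic.Gamma _).comp_analyticAt (hf.analyticAt α)
  have hpow : Differentiable ℂ fun α : ℂ => (2 : ℂ) ^ ((2 * α + 1) * N) := fun β =>
    DifferentiableAt.const_cpow (by fun_prop) (Or.inl two_ne_zero)
  unfold selbergClosedFormComplex
  refine MeromorphicAt.mul (MeromorphicAt.mul (MeromorphicAt.mul (hdiff (by fun_prop))
    (MeromorphicAt.div (MeromorphicAt.mul (hdiff (by fun_prop)) ((hGamma (by fun_prop)).pow N))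
      (MeromorphicAt.mul (hdiff hpow) ((hGamma (by fun_prop)).pow N)))) (hdiff (by fun_prop)))
    (MeromorphicAt.fun_prod fun n _ => MeromorphicAt.mul (MeromorphicAt.div
      (MeromorphicAt.mul (hGamma (by fun_prop)) (hdiff (by fun_prop)))
      (MeromorphicAt.mul (hGamma (by fun_prop)) (hGamma (by fun_prop)))) ?_)
  simp_rw [ordinaryHypergeometric_neg_natCast]
  refine MeromorphicAt.fun_sum fun k _ => MeromorphicAt.mul (MeromorphicAt.mul
    (hdiff ?_) (MeromorphicAt.inv (hdiff ?_))) (hdiff (by fun_prop))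
  · fun_prop
  · fun_prop

end Selberg

/-! ### Real exponents -/

section RealExponent

variable {a b : ℝ}

theorem ellipseWeightBase_pos {z : ℂ} (hz : z ∈ ellipseInterior a b) :
    0 < ellipseWeightBase a b z := mem_ellipseInterior_iff.1 hz

theorem ofReal_ordinaryHypergeometric (s t u x : ℝ) :
    ((ordinaryHypergeometric s t u x : ℝ) : ℂ) = ordinaryHypergeometric (s : ℂ) t u (x : ℂ) := by
  rw [ordinaryHypergeometric_eq_tsum, ordinaryHypergeometric_eq_tsum, Complex.ofReal_tsum]
  simp [ofReal_ascPochhammer_eval]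

theorem ofReal_selbergIntegrand (α : ℝ) (N : ℕ) {z : Fin N → ℂ} (hz : z ∈ ellipsePower a b N) :
    ((selbergIntegrand a b α N z : ℝ) : ℂ) = selbergIntegrandComplex a b α N z := by
  rw [selbergIntegrand, selbergIntegrandComplex, Complex.ofReal_mul, Complex.ofReal_prod]
  congr 1
  refine Finset.prod_congr rfl fun i _ => ?_
  rw [Complex.ofReal_div, Complex.ofReal_cpow (ellipseWeightBase_pos (hz i (Set.mem_univ i))).le]

theorem measurableSet_ellipsePower (a b : ℝ) (N : ℕ) : MeasurableSet (ellipsePower a b N) :=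
  MeasurableSet.univ_pi fun _ => measurableSet_ellipseInterior

theorem gegenbauerPairing_eq (α : ℝ) (n m : ℕ) {z : ℂ} (hz : z ∈ ellipseInterior a b) :
    gegenbauerPairing a b α n m z = (1 + α : ℂ) * complexGegenbauerPairing a b α n m z := by
  have haeval : ∀ (w : ℂ) (k : ℕ), Polynomial.aeval w (scaledGegenbauerPoly α (ellipseFocus a b) k)
      = (complexScaledGegenbauer α (ellipseFocus a b) k).eval w := fun w k => by
    rw [← scaledGegenbauerPoly_map_ofReal, Polynomial.eval_map]
    rfl
  have hconj : (starRingEnd ℂ) ((complexScaledGegenbauer α (ellipseFocus a b) m).eval z)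
      = (complexScaledGegenbauer α (ellipseFocus a b) m).eval ((starRingEnd ℂ) z) := by
    rw [← haeval, ← haeval]
    exact (Polynomial.aeval_algHom_apply Complex.conjAe z _).symm
  rw [gegenbauerPairing, complexGegenbauerPairing, haeval, haeval, hconj]
  push_cast
  rw [Complex.ofReal_cpow (ellipseWeightBase_pos hz).le]
  ring

theorem ofReal_gegenbauerPoly_eval (l : ℝ) (n : ℕ) (x : ℝ) :
    (((gegenbauerPoly l n).eval x : ℝ) : ℂ) = (complexGegenbauer l n).eval (x : ℂ) := by
  rw [← gegenbauerPoly_map_ofReal, Polynomial.eval_map, ← Complex.ofRealHom_eq_coe,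
    ← Complex.ofRealHom_eq_coe, Polynomial.eval₂_at_apply]

theorem integral_gegenbauerPairing (hb : 0 < b) (hab : b < a) {α : ℝ} (hα : -1 < α) (n m : ℕ) :
    ∫ z in ellipseInterior a b, gegenbauerPairing a b α n m z
      = if n = m then (1 + α : ℂ) * gegenbauerSqNorm a b α n else 0 := by
  rw [setIntegral_congr_fun measurableSet_ellipseInterior fun z hz => gegenbauerPairing_eq α n m hz,
    integral_const_mul, integral_complexGegenbauerPairing hb hab (by simpa using hα)]
  split_ifs <;> simp

theorem integrableOn_gegenbauerPairing (hb : 0 < b) (hab : b < a) {α : ℝ} (hα : -1 < α)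
    (n m : ℕ) : IntegrableOn (gegenbauerPairing a b α n m) (ellipseInterior a b) := by
  rw [integrableOn_congr_fun (fun z hz => gegenbauerPairing_eq α n m hz)
    measurableSet_ellipseInterior]
  exact (integrableOn_complexGegenbauerPairing hb hab (by simpa using hα) n m).const_mul _

theorem ofReal_gegenbauerSqNorm (a b α : ℝ) (n : ℕ) :
    (1 + α : ℂ) * gegenbauerSqNorm a b α n
      = (((n.factorial : ℝ) ^ 2 * ellipseFocus a b ^ (2 * n)
              / (2 ^ (2 * n) * (ascPochhammer ℝ n).eval (1 + α) ^ 2)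
            * ((1 + α) / (1 + α + n))
            * (gegenbauerPoly (1 + α) n).eval ((a ^ 2 + b ^ 2) / (a ^ 2 - b ^ 2)) : ℝ) : ℂ) := by
  rw [gegenbauerSqNorm]
  simp only [Complex.ofReal_mul, Complex.ofReal_div, Complex.ofReal_pow, Complex.ofReal_add,
    Complex.ofReal_natCast, Complex.ofReal_one, Complex.ofReal_ofNat, ofReal_ascPochhammer_eval,
    ofReal_gegenbauerPoly_eval, Complex.ofReal_sub]
  rw [div_pow, mul_pow, mul_pow, ← pow_mul, ← pow_mul, mul_comm 2 n]
  ring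

theorem ofReal_gegenbauerSqNorm_gamma (hb : 0 < b) (hab : b < a) {α : ℝ} (hα : -1 < α) (n : ℕ) :
    (1 + α : ℂ) * gegenbauerSqNorm a b α n
      = (((ellipseFocus a b / 2) ^ (2 * n)
            * (Real.sqrt Real.pi * Real.Gamma (2 + α) * Real.Gamma (2 + 2 * α + n)
                * Real.Gamma ((n : ℝ) + 1)
              / ((2 : ℝ) ^ (2 * α + 1) * Real.Gamma (α + 3 / 2) * Real.Gamma (1 + α + n)
                * Real.Gamma (2 + α + n)))
            * ordinaryHypergeometric (2 + 2 * α + (n : ℝ)) (-(n : ℝ)) (α + 3 / 2)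
                (-b ^ 2 / ellipseFocus a b ^ 2) : ℝ) : ℂ) := by
  have hne : (1 + α : ℂ) ≠ 0 := by exact_mod_cast (by linarith : 1 + α ≠ 0)
  have hG : Complex.Gamma (2 + α) = (1 + α) * Complex.Gamma (1 + α) := by
    rw [← Complex.Gamma_add_one _ hne]
    congr 1
    ring
  rw [gegenbauerSqNorm_eq hb hab (by simpa using hα)]
  simp only [Complex.ofReal_mul, Complex.ofReal_div, Complex.ofReal_pow, Complex.ofReal_add,
    Complex.ofReal_natCast, Complex.ofReal_one, Complex.ofReal_ofNat, Complex.ofReal_neg,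
    ofReal_ordinaryHypergeometric, ← Complex.Gamma_ofReal,
    Complex.ofReal_cpow (zero_le_two : (0 : ℝ) ≤ 2), hG]
  ring

theorem ofReal_selbergClosedForm (a b α : ℝ) (N : ℕ) :
    (((N.factorial : ℝ)
          * (Real.pi ^ ((N : ℝ) / 2) * Real.Gamma (1 + α) ^ N
              / ((2 : ℝ) ^ ((2 * α + 1) * N) * Real.Gamma (α + 3 / 2) ^ N))
          * (ellipseFocus a b / 2) ^ (N * (N - 1))
          * ∏ n ∈ Finset.range N,
              (Real.Gamma (2 + 2 * α + n) * Real.Gamma ((n : ℝ) + 1)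
                  / (Real.Gamma (1 + α + n) * Real.Gamma (2 + α + n))
                * ordinaryHypergeometric (2 + 2 * α + (n : ℝ)) (-(n : ℝ)) (α + 3 / 2)
                    (-b ^ 2 / ellipseFocus a b ^ 2)) : ℝ) : ℂ)
      = selbergClosedFormComplex a b N α := by
  rw [selbergClosedFormComplex]
  simp only [Complex.ofReal_mul, Complex.ofReal_div, Complex.ofReal_pow, Complex.ofReal_add,
    Complex.ofReal_natCast, Complex.ofReal_one, Complex.ofReal_ofNat, Complex.ofReal_neg,
    ofReal_ordinaryHypergeometric, ← Complex.Gamma_ofReal, Complex.ofReal_prod,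
    Complex.ofReal_cpow (zero_le_two : (0 : ℝ) ≤ 2), Complex.ofReal_cpow Real.pi_pos.le]

end RealExponent

theorem mainTheorem6 (a b : ℝ) (hb : 0 < b) (hab : b < a) :
    -- the monic orthogonal polynomials and their squared norms
    (∀ α : ℝ, -1 < α →
      (∀ n : ℕ, (scaledGegenbauerPoly α (ellipseFocus a b) n).Monic ∧
        (scaledGegenbauerPoly α (ellipseFocus a b) n).natDegree = n) ∧
      (∀ n m : ℕ,
        IntegrableOn (gegenbauerPairing a b α n m) (ellipseInterior a b) ∧
        (n ≠ m → ∫ z in ellipseInterior a b, gegenbauerPairing a b α n m z = 0)) ∧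
      (∀ n : ℕ,
        ∫ z in ellipseInterior a b, gegenbauerPairing a b α n n z =
          (((n.factorial : ℝ) ^ 2 * ellipseFocus a b ^ (2 * n)
              / (2 ^ (2 * n) * (ascPochhammer ℝ n).eval (1 + α) ^ 2)
            * ((1 + α) / (1 + α + n))
            * (gegenbauerPoly (1 + α) n).eval ((a ^ 2 + b ^ 2) / (a ^ 2 - b ^ 2)) : ℝ) : ℂ) ∧
        ∫ z in ellipseInterior a b, gegenbauerPairing a b α n n z =
          (((ellipseFocus a b / 2) ^ (2 * n)
            * (Real.sqrt Real.pi * Real.Gamma (2 + α) * Real.Gamma (2 + 2 * α + n)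
                * Real.Gamma ((n : ℝ) + 1)
              / ((2 : ℝ) ^ (2 * α + 1) * Real.Gamma (α + 3 / 2) * Real.Gamma (1 + α + n)
                * Real.Gamma (2 + α + n)))
            * ordinaryHypergeometric (2 + 2 * α + (n : ℝ)) (-(n : ℝ)) (α + 3 / 2)
                (-b ^ 2 / ellipseFocus a b ^ 2) : ℝ) : ℂ))) ∧
    -- the Selberg integral
    (∀ (α : ℝ), -1 < α → ∀ N : ℕ,
      IntegrableOn (selbergIntegrand a b α N) (ellipsePower a b N) ∧
      ∫ z in ellipsePower a b N, selbergIntegrand a b α N z =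
        (N.factorial : ℝ)
          * (Real.pi ^ ((N : ℝ) / 2) * Real.Gamma (1 + α) ^ N
              / ((2 : ℝ) ^ ((2 * α + 1) * N) * Real.Gamma (α + 3 / 2) ^ N))
          * (ellipseFocus a b / 2) ^ (N * (N - 1))
          * ∏ n ∈ Finset.range N,
              (Real.Gamma (2 + 2 * α + n) * Real.Gamma ((n : ℝ) + 1)
                  / (Real.Gamma (1 + α + n) * Real.Gamma (2 + α + n))
                * ordinaryHypergeometric (2 + 2 * α + (n : ℝ)) (-(n : ℝ)) (α + 3 / 2)
                    (-b ^ 2 / ellipseFocus a b ^ 2))) ∧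
    -- its analytic continuation in the exponent
    (∀ N : ℕ,
      (∀ α : ℂ, -1 < α.re →
        IntegrableOn (selbergIntegrandComplex a b α N) (ellipsePower a b N) ∧
        ∫ z in ellipsePower a b N, selbergIntegrandComplex a b α N z =
          selbergClosedFormComplex a b N α) ∧
      DifferentiableOn ℂ (fun α : ℂ =>
          ∫ z in ellipsePower a b N, selbergIntegrandComplex a b α N z) {α : ℂ | -1 < α.re} ∧
      Meromorphic (selbergClosedFormComplex a b N)) := by
  have hc := (ellipseFocus_pos hb hab).ne'
  refine ⟨fun α hα => ⟨fun n => ⟨?_, ?_⟩, fun n m => ⟨?_, ?_⟩, fun n => ⟨?_, ?_⟩⟩,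
    fun α hα N => ?_, fun N => ⟨fun α hα => ?_, ?_, meromorphic_selbergClosedFormComplex a b N⟩⟩
  · rw [Function.Injective.monic_map_iff (f := Complex.ofRealHom) Complex.ofReal_injective,
      scaledGegenbauerPoly_map_ofReal]
    exact complexScaledGegenbauer_monic (by simpa using hα) hc n
  · rw [← Polynomial.natDegree_map_eq_of_injective (f := Complex.ofRealHom) Complex.ofReal_injective,
      scaledGegenbauerPoly_map_ofReal]
    exact complexScaledGegenbauer_natDegree (by simpa using hα) hc n
  · exact integrableOn_gegenbauerPairing hb hab hα n m
  · intro hnm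
    rw [integral_gegenbauerPairing hb hab hα, if_neg hnm]
  · rw [integral_gegenbauerPairing hb hab hα, if_pos rfl, ofReal_gegenbauerSqNorm]
  · rw [integral_gegenbauerPairing hb hab hα, if_pos rfl, ofReal_gegenbauerSqNorm_gamma hb hab hα]
  · have hα' : -1 < (α : ℂ).re := by simpa using hα
    obtain ⟨hint, hval⟩ := selbergIntegralComplex hb hab hα' N
    rw [← selbergClosedFormComplex_eq hb hab hα', ← ofReal_selbergClosedForm] at hval
    have hcongr : Set.EqOn (fun z => ((selbergIntegrand a b α N z : ℝ) : ℂ))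
        (selbergIntegrandComplex a b α N) (ellipsePower a b N) :=
      fun z hz => ofReal_selbergIntegrand α N hz
    rw [← setIntegral_congr_fun (measurableSet_ellipsePower a b N) hcongr] at hval
    rw [← integrableOn_congr_fun hcongr (measurableSet_ellipsePower a b N)] at hint
    refine ⟨(by simpa using hint.re : Integrable _ _), ?_⟩
    rw [integral_complex_ofReal] at hval
    exact Complex.ofReal_injective hval
  · rw [selbergClosedFormComplex_eq hb hab hα]
    exact selbergIntegralComplex hb hab hα N
  · have h : DifferentiableOn ℂ (fun α : ℂ =>
        (N.factorial : ℂ) * ∏ n ∈ Finset.range N, gegenbauerSqNorm a b α n) {α : ℂ | -1 < α.re} :=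
      (DifferentiableOn.fun_finsetProd fun n _ => differentiableOn_gegenbauerSqNorm a b n).const_mul _
    exact h.congr fun α hα => (selbergIntegralComplex hb hab hα N).2
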